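/- **Setting.** Let $k\ge 1$, let $\mathcal K\subset\mathbb R^k$ be compact, and let $\mathbb D$ be the set of probability distributions on $\mathcal K$ having a Lebesgue density, with the $L_1$ metric $D(P,Q)=\int|p-q|$ and closed balls $\mathcal B(P,\rho)=\{Q\in\mathbb D: D(P,Q)\le\rho\}$. Fix: * a kernel $K:[0,\infty)\to[0,\infty)$ that is Lipschitz with constant $L_K$ and satisfies $\underline K\,1_{\{x\le r\}}\le K(x)\le 1_{\{x\le R\}}$ for all $x>0$, where $0<\underline K<1$ and $0<r<R<\infty$; * a density kernel $B$ that is bounded, measurable and compactly supported with $\int_{\mathbb R^k}B(\|x\|)\,dx=1$; * constants $\Lambda\ge 0$, $L>0$, $0<\beta\le1$, $f_{\max}$, $B_Y$, $c>0$, $d\ge0$. Let $\mathcal P$ be a Borel probability measure on $\mathbb D$ and $f:\mathbb D\to\mathbb R$ a functional such that * $|f(P)-f(Q)|\le L\,D(P,Q)^\beta$ for all $P,Q\in\mathbb D$, and $|f(P)|\le f_{\max}$ for $\mathcal P$-almost every $P$; * $\mathcal P$-almost every $P$ has a density that is $\Lambda$-Lipschitz on $\mathbb R^k$; * $\mathcal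 P$ is doubling with effective dimension $d$: for $\mathcal P$-almost every $s$, all $\rho>0$ and all $0<\epsilon<1$, $$\frac{\mathcal P(\mathcal B(s,\rho))}{\mathcal P(\mathcal B(s,\epsilon\rho))}\le\Big(\frac c\epsilon\Big)^d .$$ Let $m,n\ge1$ and $n_1,\dots,n_{m+1}\ge n$. Let $P_1,\dots,P_{m+1}$ be i.i.d. from $\mathcal P$. Given $P_i$, let $X_{i1},\dots,X_{in_i}$ be i.i.d. from $P_i$. Let $Y_i=f(P_i)+\mu_i$ with $\mathbb E[\mu_i\mid P_i]=0$ and $|Y_i|\le B_Y$ almost surely. Let the triples $(P_i,(X_{ij})_j,Y_i)$, $i=1,\dots,m+1$, be independent. Put $b=n^{-1/(k+2)}$ and $\hat p_i(x)=\frac1{n_i}\sum_{j}b^{-k}B(\|x-X_{ij}\|/b)$. For a bandwidth $h>0$ let $\hat K_i=K\big(\|\hat p_i-\hat p_{m+1}\|_{L_1}/h\big)$, $1\le i\le m$. Define $\hat f=\sum_{i\le m}Y_i\hat K_i\big/\sum_{i\le m}\hat K_i$ if $\sum_{i\le m}\hat K_i>0$ and $\hat f=0$ otherwise, and let $R(m,n)=\mathbb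 E\,|\hat f-f(P_{m+1})|$ be the risk. **Theorem.** There are constants $C_1,C_2,C_3>0$, depending only on $k,\mathcal K,\Lambda,K,L_K,\underline K,r,R,B,L,\beta,f_{\max},B_Y,c,d$, such that for all $\mathcal P$, $f$, $m$, $n$, $(n_i)$ and data as above: 1. For every $h>0$ the risk is finite and $$R(m,n)\le U_{m,n}(h):=\frac{C_1}{h^{d+1}n^{1/(k+2)}}+C_2h^\beta+C_3\sqrt{\frac1{m h^d}} .$$ 2. There is $c_0>0$ such that $U_{m,n}(h)\ge c_0\,m^{-\beta/(2\beta+d)}$ and $U_{m,n}(h)\ge c_0\,n^{-\beta/((k+2)(\beta+d+1))}$ for all $m,n\ge1$ and $h>0$. Hence the bandwidths in 3 are of optimal order for the bound. 3. For all $a>0$ and $0<\lambda_1\le\lambda_2$ there is $C>0$, depending only on $a,\lambda_1,\lambda_2$ and the quantities listed above, such that: * if $n\ge a\,m^{(\beta+d+1)(k+2)/(2\beta+d)}$ and $\lambda_1\le h\,m^{1/(2\beta+d)}\le\lambda_2$, then $R(m,n)\le C\,m^{-\beta/(2\beta+d)}$; * if $n\le a\,m^{(\beta+d+1)(k+2)/(2\beta+d)}$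 and $\lambda_1\le h\,n^{1/((k+2)(\beta+d+1))}\le\lambda_2$, then $R(m,n)\le C\,n^{-\beta/((k+2)(\beta+d+1))}$. -/

import Mathlib

open MeasureTheory ProbabilityTheory Set
open scoped NNReal ENNReal

universe u

noncomputable section

namespace DistReg

/-- The sample space `ℝᵏ` with its Euclidean norm. -/
abbrev E (k : ℕ) : Type := EuclideanSpace ℝ (Fin k)

/-- The set `𝔻` of probability distributions on `𝒦 ⊆ ℝᵏ` that have a density with respect to
Lebesgue measure. -/
def Distr {k : ℕ} (𝒦 : Set (E k)) : Type :=
  {P : Measure (E k) // IsProbabilityMeasure P ∧ P 𝒦ᶜ = 0 ∧ P ≪ volume}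

/-- The `L¹` distance `∫ |p - q|` of two functions on `ℝᵏ`. -/
def l1Dist {k : ℕ} (p q : E k → ℝ) : ℝ := ∫ x, |p x - q x|

namespace Distr

variable {k : ℕ} {𝒦 : Set (E k)}

/-- The underlying measure. -/
def meas (P : Distr 𝒦) : Measure (E k) := P.1

instance (P : Distr 𝒦) : IsProbabilityMeasure P.meas := P.2.1

/-- The density `p = dP/dx`. -/
def pdf (P : Distr 𝒦) : E k → ℝ := fun x => (P.meas.rnDeriv volume x).toReal

theorem integrable_pdf (P : Distr 𝒦) : Integrable P.pdf :=
  Measure.integrable_toReal_rnDeriv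

/-- `𝔻` with the `L¹` metric `D(P, Q) = ∫ |p - q|`. -/
instance : MetricSpace (Distr 𝒦) where
  dist P Q := l1Dist P.pdf Q.pdf
  dist_self P := by simp [l1Dist]
  dist_comm P Q := by simp [l1Dist, abs_sub_comm]
  dist_triangle P Q S := by
    have h1 := (P.integrable_pdf.sub Q.integrable_pdf).abs
    have h2 := (Q.integrable_pdf.sub S.integrable_pdf).abs
    have h3 := (P.integrable_pdf.sub S.integrable_pdf).abs
    calc l1Dist P.pdf S.pdf
        ≤ ∫ x, (|P.pdf x - Q.pdf x| + |Q.pdf x - S.pdf x|) :=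
          integral_mono h3 (h1.add h2) fun x => abs_sub_le _ _ _
      _ = _ := integral_add h1 h2
  eq_of_dist_eq_zero {P Q} h := by
    have h1 := (P.integrable_pdf.sub Q.integrable_pdf).abs
    have h0 : (fun x => |P.pdf x - Q.pdf x|) =ᵐ[volume] 0 :=
      (integral_eq_zero_iff_of_nonneg (fun x => abs_nonneg _) h1).1 h
    have h2 : P.meas.rnDeriv volume =ᵐ[volume] Q.meas.rnDeriv volume := by
      filter_upwards [h0, Measure.rnDeriv_lt_top P.meas volume,
        Measure.rnDeriv_lt_top Q.meas volume] with x hx hP hQ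
      have h4 : P.pdf x = Q.pdf x := sub_eq_zero.1 (abs_eq_zero.1 hx)
      exact (ENNReal.toReal_eq_toReal_iff' hP.ne hQ.ne).1 h4
    refine Subtype.ext ?_
    have hP := Measure.withDensity_rnDeriv_eq P.meas volume P.2.2.2
    have hQ := Measure.withDensity_rnDeriv_eq Q.meas volume Q.2.2.2
    calc P.1 = volume.withDensity (P.meas.rnDeriv volume) := hP.symm
      _ = volume.withDensity (Q.meas.rnDeriv volume) := withDensity_congr_ae h2
      _ = Q.1 := hQ

/-- `𝔻` carries the Borel `σ`-algebra of its `L¹` metric. -/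
instance : MeasurableSpace (Distr 𝒦) := borel _

instance : BorelSpace (Distr 𝒦) := ⟨rfl⟩

/-- `P` belongs to the class of `1`-smooth Hölder densities with constant `Λ`: it has a version
of its density that is `Λ`-Lipschitz on all of `ℝᵏ`. -/
def HasSmoothDensity (Λ : ℝ≥0) (P : Distr 𝒦) : Prop :=
  ∃ p : E k → ℝ, (∀ x, 0 ≤ p x) ∧ LipschitzWith Λ p ∧
    P.meas = volume.withDensity fun x => ENNReal.ofReal (p x)

end Distr

/-- `π` is a doubling measure with effective dimension `d` (and constant `c`), at `π`-almost every
centre `s`. The quotient is taken in `[0, ∞]`, where `x / 0 = ∞` for `x > 0`; for `r ≥ 2` the ball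
in the numerator is the whole space. -/
def IsDoubling {k : ℕ} {𝒦 : Set (E k)} (π : Measure (Distr 𝒦)) (c d : ℝ) : Prop :=
  ∀ᵐ s ∂π, ∀ r : ℝ, 0 < r → ∀ ε : ℝ, 0 < ε → ε < 1 →
    π (Metric.closedBall s r) / π (Metric.closedBall s (ε * r)) ≤ ENNReal.ofReal ((c / ε) ^ d)

/-- The assumptions on the kernel `K : [0, ∞) → ℝ` of the regression estimator. -/
structure IsRegressionKernel (K : ℝ → ℝ) (LK : ℝ≥0) (Klow r R : ℝ) : Prop where
  lipschitz : LipschitzOnWith LK K (Ici 0)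
  nonneg : ∀ x, 0 ≤ x → 0 ≤ K x
  Klow_pos : 0 < Klow
  Klow_lt_one : Klow < 1
  r_pos : 0 < r
  r_lt_R : r < R
  lower : ∀ x, 0 < x → Klow * (Metric.closedBall (0 : ℝ) r).indicator 1 x ≤ K x
  upper : ∀ x, 0 < x → K x ≤ (Metric.closedBall (0 : ℝ) R).indicator 1 x

/-- The assumptions on the kernel `B : [0, ∞) → ℝ` of the density estimator on `ℝᵏ`. -/
structure IsDensityKernel (k : ℕ) (B : ℝ → ℝ) : Prop where
  measurable : Measurable B
  bounded : ∃ M : ℝ, ∀ t, 0 ≤ t → |B t| ≤ M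
  compactSupport : ∃ ρ : ℝ, ∀ t, ρ < t → B t = 0
  integral_eq_one : ∫ x : E k, B ‖x‖ = 1

/-- Kernel density estimator with kernel `B` and bandwidth `b` based on the sample `x`. -/
def kde {k : ℕ} (B : ℝ → ℝ) (b : ℝ) {N : ℕ} (x : Fin N → E k) (u : E k) : ℝ :=
  (1 / (N : ℝ)) * ∑ j, (1 / b ^ k) * B (‖u - x j‖ / b)

/-- Kernel-kernel estimator: prediction at the last sample `x (Fin.last m)` from the first `m`
samples `x i` and their responses `y i`. -/
def kkEstimator {k m : ℕ} (K B : ℝ → ℝ) (h b : ℝ) {N : Fin (m + 1) → ℕ}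
    (x : ∀ i, Fin (N i) → E k) (y : Fin m → ℝ) : ℝ :=
  let w : Fin m → ℝ := fun i =>
    K (l1Dist (kde B b (x i.castSucc)) (kde B b (x (Fin.last m))) / h)
  if 0 < ∑ i, w i then (∑ i, y i * w i) / ∑ i, w i else 0

/-- Assumptions on the law `π` of the covariate and on the regression functional `f`. -/
structure IsAdmissible {k : ℕ} {𝒦 : Set (E k)} (Λ : ℝ≥0) (L β fmax c d : ℝ)
    (π : Measure (Distr 𝒦)) (f : Distr 𝒦 → ℝ) : Prop where
  isProbabilityMeasure : IsProbabilityMeasure π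
  holder : ∀ P Q, |f P - f Q| ≤ L * dist P Q ^ β
  smooth : ∀ᵐ P ∂π, P.HasSmoothDensity Λ
  bounded : ∀ᵐ P ∂π, |f P| ≤ fmax
  doubling : IsDoubling π c d

/-- The data: `P i` are i.i.d. with law `π`; given `P i`, the points `X i j`, `j < N i`, are i.i.d.
with law `P i`; `Y i = f (P i) + μ i` with centred noise and `|Y i| ≤ BY`; the triples
`(P i, X i, Y i)` are independent. The index `Fin.last m` is the new covariate. -/
structure IsSample {k m : ℕ} {𝒦 : Set (E k)} {Ω : Type u} [MeasurableSpace Ω] (Pr : Measure Ω)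
    (π : Measure (Distr 𝒦)) (f : Distr 𝒦 → ℝ) (BY : ℝ) (N : Fin (m + 1) → ℕ)
    (P : Fin (m + 1) → Ω → Distr 𝒦) (X : ∀ i : Fin (m + 1), Fin (N i) → Ω → E k)
    (Y μ : Fin (m + 1) → Ω → ℝ) : Prop where
  isProbabilityMeasure : IsProbabilityMeasure Pr
  measurable_P : ∀ i, Measurable (P i)
  measurable_X : ∀ i j, Measurable (X i j)
  measurable_Y : ∀ i, Measurable (Y i)
  law_P : ∀ i, Pr.map (P i) = π
  law_X : ∀ i, ∀ A : Set (Distr 𝒦), MeasurableSet A →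
    ∀ S : Fin (N i) → Set (E k), (∀ j, MeasurableSet (S j)) →
      Pr {ω | P i ω ∈ A ∧ ∀ j, X i j ω ∈ S j} = ∫⁻ p in A, ∏ j, p.meas (S j) ∂π
  model : ∀ i ω, Y i ω = f (P i ω) + μ i ω
  integrable_noise : ∀ i, Integrable (μ i) Pr
  centred_noise : ∀ i, Pr[μ i | MeasurableSpace.comap (P i) inferInstance] =ᵐ[Pr] 0
  bounded_Y : ∀ i, ∀ᵐ ω ∂Pr, |Y i ω| ≤ BY
  indep : iIndepFun
    (fun i ω => ((P i ω, fun j => X i j ω, Y i ω) : Distr 𝒦 × (Fin (N i) → E k) × ℝ)) Pr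

/-- The absolute error `|f̂(P̂; P̂₁, …, P̂ₘ) - f(P)|` at the outcome `ω`, where all density estimators
use the bandwidth `b = n ^ (-1 / (k + 2))`. -/
def absError {k m : ℕ} {𝒦 : Set (E k)} {Ω : Type u} (K B : ℝ → ℝ) (h : ℝ) (n : ℕ)
    (f : Distr 𝒦 → ℝ) {N : Fin (m + 1) → ℕ} (P : Fin (m + 1) → Ω → Distr 𝒦)
    (X : ∀ i : Fin (m + 1), Fin (N i) → Ω → E k) (Y : Fin (m + 1) → Ω → ℝ) (ω : Ω) : ℝ :=
  |kkEstimator K B h ((n : ℝ) ^ (-1 / ((k : ℝ) + 2))) (fun i j => X i j ω)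
      (fun i => Y i.castSucc ω) - f (P (Fin.last m) ω)|

/-- The risk `R(m, n)`. -/
def risk {k m : ℕ} {𝒦 : Set (E k)} {Ω : Type u} [MeasurableSpace Ω] (Pr : Measure Ω)
    (K B : ℝ → ℝ) (h : ℝ) (n : ℕ) (f : Distr 𝒦 → ℝ) {N : Fin (m + 1) → ℕ}
    (P : Fin (m + 1) → Ω → Distr 𝒦) (X : ∀ i : Fin (m + 1), Fin (N i) → Ω → E k)
    (Y : Fin (m + 1) → Ω → ℝ) : ℝ :=
  ∫ ω, absError K B h n f P X Y ω ∂Pr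

/-- The right-hand side `C₁ / (h^(d+1) n^(1/(k+2))) + C₂ h^β + C₃ √(1 / (m h^d))`. -/
def riskBound (C₁ C₂ C₃ : ℝ) (k : ℕ) (β d : ℝ) (m n : ℕ) (h : ℝ) : ℝ :=
  C₁ / (h ^ (d + 1) * (n : ℝ) ^ (1 / ((k : ℝ) + 2))) + C₂ * h ^ β
    + C₃ * Real.sqrt (1 / ((m : ℝ) * h ^ d))

/-- The rate `m ^ (-β / (2β + d))`. -/
def rateM (β d : ℝ) (m : ℕ) : ℝ := (m : ℝ) ^ (-β / (2 * β + d))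

/-- The rate `n ^ (-β / ((k + 2) (β + d + 1)))`. -/
def rateN (k : ℕ) (β d : ℝ) (n : ℕ) : ℝ :=
  (n : ℝ) ^ (-β / (((k : ℝ) + 2) * (β + d + 1)))

/-- The bandwidth order `m ^ (-1 / (2β + d))`. -/
def bandM (β d : ℝ) (m : ℕ) : ℝ := (m : ℝ) ^ (-1 / (2 * β + d))

/-- The bandwidth order `n ^ (-1 / ((k + 2) (β + d + 1)))`. -/
def bandN (k : ℕ) (β d : ℝ) (n : ℕ) : ℝ :=
  (n : ℝ) ^ (-1 / (((k : ℝ) + 2) * (β + d + 1)))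

/-- The order `m ^ ((β + d + 1) (k + 2) / (2β + d))` of `n` that separates the two regimes. -/
def threshold (k : ℕ) (β d : ℝ) (m : ℕ) : ℝ :=
  (m : ℝ) ^ ((β + d + 1) * ((k : ℝ) + 2) / (2 * β + d))

end DistReg

end

namespace DistReg

section Rates

theorem one_div_rpow_mul_rpow {x : ℝ} (hx : 0 < x) (a b c : ℝ) (h : a + b = -c) :
    1 / (x ^ a * x ^ b) = x ^ c := by
  rw [← Real.rpow_add hx, h, one_div, Real.rpow_neg hx.le, inv_inv]

theorem bandM_pos {β d : ℝ} {m : ℕ} (hm : 1 ≤ m) : 0 < bandM β d m :=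
  Real.rpow_pos_of_pos (by exact_mod_cast hm) _

theorem rateM_pos {β d : ℝ} {m : ℕ} (hm : 1 ≤ m) : 0 < rateM β d m :=
  Real.rpow_pos_of_pos (by exact_mod_cast hm) _

theorem bandN_pos {k : ℕ} {β d : ℝ} {n : ℕ} (hn : 1 ≤ n) : 0 < bandN k β d n :=
  Real.rpow_pos_of_pos (by exact_mod_cast hn) _

theorem rateN_pos {k : ℕ} {β d : ℝ} {n : ℕ} (hn : 1 ≤ n) : 0 < rateN k β d n :=
  Real.rpow_pos_of_pos (by exact_mod_cast hn) _

theorem threshold_pos {k : ℕ} {β d : ℝ} {m : ℕ} (hm : 1 ≤ m) : 0 < threshold k β d m :=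
  Real.rpow_pos_of_pos (by exact_mod_cast hm) _

theorem bandM_rpow (β d : ℝ) (m : ℕ) : bandM β d m ^ β = rateM β d m := by
  rw [bandM, rateM, ← Real.rpow_mul (Nat.cast_nonneg m)]
  congr 1; ring

theorem bandN_rpow (k : ℕ) (β d : ℝ) (n : ℕ) : bandN k β d n ^ β = rateN k β d n := by
  rw [bandN, rateN, ← Real.rpow_mul (Nat.cast_nonneg n)]
  congr 1; ring

theorem one_div_mul_bandM_rpow {β d : ℝ} (hβ : 0 < β) (hd : 0 ≤ d) {m : ℕ} (hm : 1 ≤ m) :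
    1 / (m * bandM β d m ^ d) = rateM β d m ^ 2 := by
  have h0 : (0 : ℝ) < m := by exact_mod_cast hm
  rw [bandM, rateM, ← Real.rpow_mul h0.le, ← Real.rpow_natCast, ← Real.rpow_mul h0.le]
  conv_lhs => enter [2, 1]; rw [← Real.rpow_one (m : ℝ)]
  refine one_div_rpow_mul_rpow h0 _ _ _ ?_
  field_simp
  push_cast
  ring

theorem one_div_bandM_rpow_mul_threshold {β d : ℝ} (hβ : 0 < β) (hd : 0 ≤ d) (k : ℕ) {m : ℕ}
    (hm : 1 ≤ m) :
    1 / (bandM β d m ^ (d + 1) * threshold k β d m ^ (1 / ((k : ℝ) + 2))) = rateM β d m := by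
  have h0 : (0 : ℝ) < m := by exact_mod_cast hm
  rw [bandM, rateM, threshold, ← Real.rpow_mul h0.le, ← Real.rpow_mul h0.le]
  refine one_div_rpow_mul_rpow h0 _ _ _ ?_
  field_simp
  ring

theorem one_div_bandN_rpow_mul {β d : ℝ} (hβ : 0 < β) (hd : 0 ≤ d) (k : ℕ) {n : ℕ}
    (hn : 1 ≤ n) :
    1 / (bandN k β d n ^ (d + 1) * (n : ℝ) ^ (1 / ((k : ℝ) + 2))) = rateN k β d n := by
  have h0 : (0 : ℝ) < n := by exact_mod_cast hn
  rw [bandN, rateN, ← Real.rpow_mul h0.le]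
  refine one_div_rpow_mul_rpow h0 _ _ _ ?_
  field_simp
  ring

theorem one_div_rpow_mul_bandN_rpow {β d : ℝ} (hβ : 0 < β) (hd : 0 ≤ d) (k : ℕ) {n : ℕ}
    (hn : 1 ≤ n) :
    1 / ((n : ℝ) ^ ((2 * β + d) / ((β + d + 1) * ((k : ℝ) + 2))) * bandN k β d n ^ d)
      = rateN k β d n ^ 2 := by
  have h0 : (0 : ℝ) < n := by exact_mod_cast hn
  rw [bandN, rateN, ← Real.rpow_mul h0.le, ← Real.rpow_natCast, ← Real.rpow_mul h0.le]
  refine one_div_rpow_mul_rpow h0 _ _ _ ?_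
  field_simp
  push_cast
  ring

theorem le_riskBound_rateM {C₁ C₂ C₃ : ℝ} (h₁ : 0 < C₁) (h₂ : 0 < C₂) (h₃ : 0 < C₃) (k : ℕ)
    {β d : ℝ} (hβ : 0 < β) (hd : 0 ≤ d) {m n : ℕ} (hm : 1 ≤ m) {h : ℝ} (hh : 0 < h) :
    min C₁ (min C₂ C₃) * rateM β d m ≤ riskBound C₁ C₂ C₃ k β d m n h := by
  have hr := rateM_pos (β := β) (d := d) hm
  have hb := bandM_pos (β := β) (d := d) hm
  have h0 : (0 : ℝ) < m := by exact_mod_cast hm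
  have t1 : 0 ≤ C₁ / (h ^ (d + 1) * (n : ℝ) ^ (1 / ((k : ℝ) + 2))) := by positivity
  have t2 : 0 ≤ C₂ * h ^ β := by positivity
  have t3 : 0 ≤ C₃ * Real.sqrt (1 / ((m : ℝ) * h ^ d)) := by positivity
  unfold riskBound
  rcases le_total (bandM β d m) h with hle | hle
  · have : rateM β d m ≤ h ^ β := by
      rw [← bandM_rpow]; exact Real.rpow_le_rpow hb.le hle hβ.le
    have h4 : min C₁ (min C₂ C₃) * rateM β d m ≤ C₂ * h ^ β :=
      mul_le_mul ((min_le_right _ _).trans (min_le_left _ _)) this hr.le h₂.le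
    linarith
  · have : rateM β d m ≤ Real.sqrt (1 / ((m : ℝ) * h ^ d)) := by
      apply Real.le_sqrt_of_sq_le
      rw [← one_div_mul_bandM_rpow hβ hd hm]
      gcongr
    have h4 : min C₁ (min C₂ C₃) * rateM β d m ≤ C₃ * Real.sqrt (1 / ((m : ℝ) * h ^ d)) :=
      mul_le_mul ((min_le_right _ _).trans (min_le_right _ _)) this hr.le h₃.le
    linarith

theorem le_riskBound_rateN {C₁ C₂ C₃ : ℝ} (h₁ : 0 < C₁) (h₂ : 0 < C₂) (h₃ : 0 < C₃) (k : ℕ)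
    {β d : ℝ} (hβ : 0 < β) (hd : 0 ≤ d) {m n : ℕ} (hn : 1 ≤ n) {h : ℝ} (hh : 0 < h) :
    min C₁ (min C₂ C₃) * rateN k β d n ≤ riskBound C₁ C₂ C₃ k β d m n h := by
  have hr := rateN_pos (k := k) (β := β) (d := d) hn
  have hb := bandN_pos (k := k) (β := β) (d := d) hn
  have h0 : (0 : ℝ) < n := by exact_mod_cast hn
  have t1 : 0 ≤ C₁ / (h ^ (d + 1) * (n : ℝ) ^ (1 / ((k : ℝ) + 2))) := by positivity
  have t2 : 0 ≤ C₂ * h ^ β := by positivity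
  have t3 : 0 ≤ C₃ * Real.sqrt (1 / ((m : ℝ) * h ^ d)) := by positivity
  unfold riskBound
  rcases le_total (bandN k β d n) h with hle | hle
  · have : rateN k β d n ≤ h ^ β := by
      rw [← bandN_rpow]; exact Real.rpow_le_rpow hb.le hle hβ.le
    have h4 : min C₁ (min C₂ C₃) * rateN k β d n ≤ C₂ * h ^ β :=
      mul_le_mul ((min_le_right _ _).trans (min_le_left _ _)) this hr.le h₂.le
    linarith
  · have : rateN k β d n ≤ 1 / (h ^ (d + 1) * (n : ℝ) ^ (1 / ((k : ℝ) + 2))) := by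
      rw [← one_div_bandN_rpow_mul hβ hd k hn]
      gcongr
    have h4 : min C₁ (min C₂ C₃) * rateN k β d n ≤
        C₁ * (1 / (h ^ (d + 1) * (n : ℝ) ^ (1 / ((k : ℝ) + 2)))) :=
      mul_le_mul (min_le_left _ _) this hr.le h₁.le
    rw [mul_one_div] at h4
    linarith

theorem riskBound_le_rateM {C₁ C₂ C₃ : ℝ} (h₁ : 0 < C₁) (h₂ : 0 < C₂) (h₃ : 0 < C₃) (k : ℕ)
    {β d : ℝ} (hβ : 0 < β) (hd : 0 ≤ d) {a lo hi : ℝ} (ha : 0 < a) (hlo : 0 < lo)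
    {m n : ℕ} (hm : 1 ≤ m) {h : ℝ} (hn : a * threshold k β d m ≤ n)
    (h_lo : lo * bandM β d m ≤ h) (h_hi : h ≤ hi * bandM β d m) (hlh : lo ≤ hi) :
    riskBound C₁ C₂ C₃ k β d m n h ≤
      (C₁ / (lo ^ (d + 1) * a ^ (1 / ((k : ℝ) + 2))) + C₂ * hi ^ β
        + C₃ * Real.sqrt (1 / lo ^ d)) * rateM β d m := by
  have hr := rateM_pos (β := β) (d := d) hm
  have hb := bandM_pos (β := β) (d := d) hm
  have ht := threshold_pos (k := k) (β := β) (d := d) hm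
  have h0 : (0 : ℝ) < m := by exact_mod_cast hm
  have hh : 0 < h := (mul_pos hlo hb).trans_le h_lo
  have hhi : 0 < hi := hlo.trans_le hlh
  rw [riskBound, add_mul, add_mul]
  gcongr ?_ + ?_ + ?_
  · calc C₁ / (h ^ (d + 1) * (n : ℝ) ^ (1 / ((k : ℝ) + 2)))
        ≤ C₁ / ((lo * bandM β d m) ^ (d + 1) *
            (a * threshold k β d m) ^ (1 / ((k : ℝ) + 2))) := by gcongr
      _ = C₁ / (lo ^ (d + 1) * a ^ (1 / ((k : ℝ) + 2))) * rateM β d m := by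
        rw [← one_div_bandM_rpow_mul_threshold hβ hd k hm, Real.mul_rpow hlo.le hb.le,
          Real.mul_rpow ha.le ht.le]
        rw [div_mul_div_comm, mul_one]
        congr 1; ring
  · calc C₂ * h ^ β ≤ C₂ * (hi * bandM β d m) ^ β := by gcongr
      _ = _ := by rw [Real.mul_rpow hhi.le hb.le, bandM_rpow, mul_assoc]
  · calc C₃ * Real.sqrt (1 / (m * h ^ d)) ≤ C₃ * Real.sqrt (1 / (m * (lo * bandM β d m) ^ d)) := by
          gcongr
      _ = C₃ * Real.sqrt (1 / lo ^ d * rateM β d m ^ 2) := by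
          rw [← one_div_mul_bandM_rpow hβ hd hm, Real.mul_rpow hlo.le hb.le, div_mul_div_comm,
            one_mul]
          congr 3; ring
      _ = _ := by
          rw [Real.sqrt_mul (by positivity), Real.sqrt_sq hr.le, mul_assoc]

theorem riskBound_le_rateN {C₁ C₂ C₃ : ℝ} (h₁ : 0 < C₁) (h₂ : 0 < C₂) (h₃ : 0 < C₃) (k : ℕ)
    {β d : ℝ} (hβ : 0 < β) (hd : 0 ≤ d) {a lo hi : ℝ} (ha : 0 < a) (hlo : 0 < lo)
    {m n : ℕ} (hm : 1 ≤ m) (hn1 : 1 ≤ n) {h : ℝ} (hn : n ≤ a * threshold k β d m)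
    (h_lo : lo * bandN k β d n ≤ h) (h_hi : h ≤ hi * bandN k β d n) (hlh : lo ≤ hi) :
    riskBound C₁ C₂ C₃ k β d m n h ≤
      (C₁ / lo ^ (d + 1) + C₂ * hi ^ β
        + C₃ * Real.sqrt (a ^ ((2 * β + d) / ((β + d + 1) * ((k : ℝ) + 2))) / lo ^ d))
          * rateN k β d n := by
  have hr := rateN_pos (k := k) (β := β) (d := d) hn1
  have hb := bandN_pos (k := k) (β := β) (d := d) hn1
  have ht := threshold_pos (k := k) (β := β) (d := d) hm
  have h0 : (0 : ℝ) < m := by exact_mod_cast hm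
  have h0n : (0 : ℝ) < n := by exact_mod_cast hn1
  have hh : 0 < h := (mul_pos hlo hb).trans_le h_lo
  have hhi : 0 < hi := hlo.trans_le hlh
  have hmge : (n : ℝ) ^ ((2 * β + d) / ((β + d + 1) * ((k : ℝ) + 2))) /
      a ^ ((2 * β + d) / ((β + d + 1) * ((k : ℝ) + 2))) ≤ m := by
    rw [← Real.div_rpow h0n.le ha.le]
    calc ((n : ℝ) / a) ^ ((2 * β + d) / ((β + d + 1) * ((k : ℝ) + 2)))
        ≤ threshold k β d m ^ ((2 * β + d) / ((β + d + 1) * ((k : ℝ) + 2))) := by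
          gcongr
          rwa [div_le_iff₀' ha]
      _ = m := by
          rw [threshold, ← Real.rpow_mul h0.le]
          conv_rhs => rw [← Real.rpow_one (m : ℝ)]
          congr 1
          field_simp
  rw [riskBound, add_mul, add_mul]
  gcongr ?_ + ?_ + ?_
  · calc C₁ / (h ^ (d + 1) * (n : ℝ) ^ (1 / ((k : ℝ) + 2)))
        ≤ C₁ / ((lo * bandN k β d n) ^ (d + 1) * (n : ℝ) ^ (1 / ((k : ℝ) + 2))) := by gcongr
      _ = C₁ / lo ^ (d + 1) * rateN k β d n := by
        rw [← one_div_bandN_rpow_mul hβ hd k hn1, Real.mul_rpow hlo.le hb.le]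
        rw [div_mul_div_comm, mul_one, mul_assoc]
  · calc C₂ * h ^ β ≤ C₂ * (hi * bandN k β d n) ^ β := by gcongr
      _ = _ := by rw [Real.mul_rpow hhi.le hb.le, bandN_rpow, mul_assoc]
  · set e := (2 * β + d) / ((β + d + 1) * ((k : ℝ) + 2))
    calc C₃ * Real.sqrt (1 / (m * h ^ d))
        ≤ C₃ * Real.sqrt (1 / ((n : ℝ) ^ e / a ^ e * (lo * bandN k β d n) ^ d)) := by
          gcongr
      _ = C₃ * Real.sqrt (a ^ e / lo ^ d * rateN k β d n ^ 2) := by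
          rw [← one_div_rpow_mul_bandN_rpow hβ hd k hn1, Real.mul_rpow hlo.le hb.le]
          congr 2
          have := Real.rpow_pos_of_pos hb d
          have := Real.rpow_pos_of_pos h0n e
          have := Real.rpow_pos_of_pos ha e
          have := Real.rpow_pos_of_pos hlo d
          field_simp
          rfl
      _ = _ := by
          rw [Real.sqrt_mul (by positivity), Real.sqrt_sq hr.le, mul_assoc]

end Rates

namespace Distr

variable {k : ℕ} {𝒦 : Set (E k)}

theorem pdf_nonneg (P : Distr 𝒦) (x : E k) : 0 ≤ P.pdf x := ENNReal.toReal_nonneg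

theorem meas_ac (P : Distr 𝒦) : P.meas ≪ volume := P.2.2.2

theorem meas_compl (P : Distr 𝒦) : P.meas 𝒦ᶜ = 0 := P.2.2.1

theorem setIntegral_pdf (P : Distr 𝒦) (S : Set (E k)) : ∫ x in S, P.pdf x = P.meas.real S :=
  Measure.setIntegral_toReal_rnDeriv P.meas_ac S

theorem integral_pdf (P : Distr 𝒦) : ∫ x, P.pdf x = 1 := by
  rw [← setIntegral_univ, setIntegral_pdf, probReal_univ]

theorem dist_eq (P Q : Distr 𝒦) : dist P Q = l1Dist P.pdf Q.pdf := rfl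

theorem dist_le_two (P Q : Distr 𝒦) : dist P Q ≤ 2 := by
  have h1 := P.integrable_pdf
  have h2 := Q.integrable_pdf
  calc dist P Q ≤ ∫ x, (P.pdf x + Q.pdf x) :=
        integral_mono (h1.sub h2).abs (h1.add h2) fun x => by
          have := P.pdf_nonneg x
          have := Q.pdf_nonneg x
          simp only [abs_le]
          constructor <;> linarith
    _ = 2 := by rw [integral_add h1 h2, integral_pdf, integral_pdf]; norm_num

theorem isometry_toL1 :
    Isometry fun P : Distr 𝒦 => (P.integrable_pdf.toL1 P.pdf : E k →₁[volume] ℝ) := by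
  refine Isometry.of_dist_eq fun P Q => ?_
  rw [dist_eq_norm, ← Integrable.toL1_sub, L1.norm_of_fun_eq_integral_norm]
  rfl

instance : SecondCountableTopology (Distr 𝒦) :=
  haveI : Fact ((1 : ℝ≥0∞) ≠ ∞) := ⟨ENNReal.one_ne_top⟩
  (isometry_toL1 (𝒦 := 𝒦)).isEmbedding.secondCountableTopology

theorem abs_measReal_sub_le (P Q : Distr 𝒦) (S : Set (E k)) :
    |P.meas.real S - Q.meas.real S| ≤ dist P Q := by
  have h1 := P.integrable_pdf
  have h2 := Q.integrable_pdf
  rw [← setIntegral_pdf, ← setIntegral_pdf, ← integral_sub h1.integrableOn h2.integrableOn]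
  calc |∫ x in S, (P.pdf x - Q.pdf x)| ≤ ∫ x in S, |P.pdf x - Q.pdf x| :=
        abs_integral_le_integral_abs
    _ ≤ _ := setIntegral_le_integral (h1.sub h2).abs (ae_of_all _ fun x => abs_nonneg _)

theorem continuous_measReal (S : Set (E k)) : Continuous fun P : Distr 𝒦 => P.meas.real S := by
  refine LipschitzWith.continuous (K := 1) (LipschitzWith.of_dist_le_mul fun P Q => ?_)
  rw [Real.dist_eq, NNReal.coe_one, one_mul]
  exact abs_measReal_sub_le P Q S

theorem measurable_meas : Measurable (meas : Distr 𝒦 → Measure (E k)) := by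
  refine Measure.measurable_of_measurable_coe _ fun S _ => ?_
  have := (continuous_measReal (𝒦 := 𝒦) S).measurable.ennreal_ofReal
  have heq : ∀ P : Distr 𝒦, ENNReal.ofReal (P.meas.real S) = P.meas S := fun P =>
    ofReal_measureReal
  simpa only [heq] using this

variable (𝒦) in
/-- The Markov kernel that samples a point from a distribution in `𝔻`. -/
noncomputable def kernel : Kernel (Distr 𝒦) (E k) := ⟨meas, measurable_meas⟩

@[simp]
theorem kernel_apply (P : Distr 𝒦) : kernel 𝒦 P = P.meas := rfl

instance : IsMarkovKernel (kernel 𝒦) := ⟨fun P => inferInstanceAs (IsProbabilityMeasure P.meas)⟩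

end Distr

section Doubling

variable {k : ℕ} {𝒦 : Set (E k)} {π : Measure (Distr 𝒦)} {c d : ℝ}

theorem IsDoubling.rpow_le_measReal_closedBall [IsProbabilityMeasure π] (hπ : IsDoubling π c d)
    (hc : 0 < c) :
    ∀ᵐ s ∂π, ∀ ρ : ℝ, 0 < ρ → ρ < 2 → (ρ / (2 * c)) ^ d ≤ π.real (Metric.closedBall s ρ) := by
  filter_upwards [hπ] with s hs ρ h0 h2
  have h := hs 2 two_pos (ρ / 2) (by positivity) (by linarith)
  have huniv : Metric.closedBall s 2 = univ :=
    eq_univ_of_forall fun P => Distr.dist_le_two P s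
  rw [huniv, measure_univ, div_mul_cancel₀ _ two_ne_zero] at h
  have hpos : π (Metric.closedBall s ρ) ≠ 0 := fun h0 => by
    rw [h0, ENNReal.div_zero one_ne_zero] at h
    exact ENNReal.ofReal_ne_top (top_le_iff.1 h)
  have hposR : 0 < π.real (Metric.closedBall s ρ) :=
    ENNReal.toReal_pos hpos (measure_ne_top _ _)
  have h3 := ENNReal.toReal_mono ENNReal.ofReal_ne_top h
  have hcd : 0 < (c / (ρ / 2)) ^ d := by positivity
  rw [ENNReal.toReal_div, ENNReal.toReal_one, ENNReal.toReal_ofReal hcd.le] at h3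
  change 1 / π.real _ ≤ _ at h3
  rw [div_le_iff₀ hposR] at h3
  have h4 : (ρ / (2 * c)) ^ d * (c / (ρ / 2)) ^ d = 1 := by
    rw [← Real.mul_rpow (by positivity) (by positivity)]
    rw [show ρ / (2 * c) * (c / (ρ / 2)) = 1 by field_simp, Real.one_rpow]
  calc (ρ / (2 * c)) ^ d = (ρ / (2 * c)) ^ d * 1 := (mul_one _).symm
    _ ≤ (ρ / (2 * c)) ^ d * ((c / (ρ / 2)) ^ d * π.real (Metric.closedBall s ρ)) := by gcongr
    _ = _ := by rw [← mul_assoc, h4, one_mul]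

theorem IsDoubling.measReal_closedBall_pos [IsProbabilityMeasure π] (hπ : IsDoubling π c d)
    (hc : 0 < c) : ∀ᵐ s ∂π, ∀ ρ : ℝ, 0 < ρ → 0 < π.real (Metric.closedBall s ρ) := by
  filter_upwards [hπ.rpow_le_measReal_closedBall hc] with s hs ρ h0
  have h1 := hs (min ρ 1) (by positivity) ((min_le_right _ _).trans_lt (by norm_num))
  have h2 : 0 < (min ρ 1 / (2 * c)) ^ d := by positivity
  exact (h2.trans_le h1).trans_le
    (measureReal_mono (Metric.closedBall_subset_closedBall (min_le_left _ _)))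

theorem IsDoubling.measReal_closedBall_le [IsProbabilityMeasure π] (hπ : IsDoubling π c d)
    (hc : 0 < c) :
    ∀ᵐ s ∂π, ∀ ρ : ℝ, 0 < ρ → ∀ ε : ℝ, 0 < ε → ε < 1 →
      π.real (Metric.closedBall s ρ) ≤ (c / ε) ^ d * π.real (Metric.closedBall s (ε * ρ)) := by
  filter_upwards [hπ, hπ.measReal_closedBall_pos hc] with s hs hpos ρ hρ ε hε hε1
  have h3 := ENNReal.toReal_mono ENNReal.ofReal_ne_top (hs ρ hρ ε hε hε1)
  rw [ENNReal.toReal_div, ENNReal.toReal_ofReal (by positivity)] at h3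
  exact (div_le_iff₀ (hpos _ (by positivity))).1 h3

theorem measurable_measReal_closedBall [IsProbabilityMeasure π] (ρ : ℝ) :
    Measurable fun s => π.real (Metric.closedBall s ρ) := by
  have hS : MeasurableSet {p : Distr 𝒦 × Distr 𝒦 | dist p.2 p.1 ≤ ρ} :=
    measurableSet_le (measurable_snd.dist measurable_fst) measurable_const
  exact (measurable_measure_prodMk_left hS).ennreal_toReal

end Doubling

section L1

variable {k : ℕ} {p q s : E k → ℝ}

theorem l1Dist_nonneg (p q : E k → ℝ) : 0 ≤ l1Dist p q := integral_nonneg fun _ => abs_nonneg _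

theorem l1Dist_comm (p q : E k → ℝ) : l1Dist p q = l1Dist q p := by
  simp only [l1Dist, abs_sub_comm]

theorem l1Dist_triangle (hp : Integrable p) (hq : Integrable q) (hs : Integrable s) :
    l1Dist p s ≤ l1Dist p q + l1Dist q s := by
  have h1 := (hp.sub hq).abs
  have h2 := (hq.sub hs).abs
  calc l1Dist p s ≤ ∫ x, (|p x - q x| + |q x - s x|) :=
        integral_mono (hp.sub hs).abs (h1.add h2) fun x => abs_sub_le _ _ _
    _ = _ := integral_add h1 h2

end L1

/-- `B` is measurable, bounded by `M` on `[0, ∞)`, and vanishes beyond `ρ`. -/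
structure HasKernelBound (B : ℝ → ℝ) (M ρ : ℝ) : Prop where
  measurable : Measurable B
  bound_nonneg : 0 ≤ M
  radius_nonneg : 0 ≤ ρ
  abs_le : ∀ t, 0 ≤ t → |B t| ≤ M
  eq_zero : ∀ t, ρ < t → B t = 0

theorem IsDensityKernel.exists_hasKernelBound {k : ℕ} {B : ℝ → ℝ} (hB : IsDensityKernel k B) :
    ∃ M ρ : ℝ, HasKernelBound B M ρ := by
  obtain ⟨M, hM⟩ := hB.bounded
  obtain ⟨ρ, hρ⟩ := hB.compactSupport
  exact ⟨M, |ρ|, hB.measurable, (abs_nonneg _).trans (hM 0 le_rfl), abs_nonneg _, hM,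
    fun t ht => hρ t ((le_abs_self ρ).trans_lt ht)⟩

/-- The rescaled density kernel `x ↦ b⁻ᵏ B(‖x‖ / b)` on `ℝᵏ`. -/
noncomputable def scaledKernel (k : ℕ) (B : ℝ → ℝ) (b : ℝ) (x : E k) : ℝ :=
  (1 / b ^ k) * B (‖x‖ / b)

theorem kde_eq {k N : ℕ} (B : ℝ → ℝ) (b : ℝ) (x : Fin N → E k) (u : E k) :
    kde B b x u = (1 / (N : ℝ)) * ∑ j, scaledKernel k B b (u - x j) := rfl

section ScaledKernel

variable {k : ℕ} {B : ℝ → ℝ} {M ρ b : ℝ}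

theorem measurable_scaledKernel (hB : Measurable B) : Measurable (scaledKernel k B b) :=
  (hB.comp (measurable_norm.div_const b)).const_mul _

theorem abs_scaledKernel_le (hB : HasKernelBound B M ρ) (hb : 0 < b) (x : E k) :
    |scaledKernel k B b x| ≤ M / b ^ k := by
  rw [scaledKernel, abs_mul, abs_of_nonneg (by positivity), one_div_mul_eq_div]
  gcongr
  exact hB.abs_le _ (by positivity)

theorem scaledKernel_eq_zero (hB : HasKernelBound B M ρ) (hb : 0 < b) {x : E k}
    (hx : ρ * b < ‖x‖) : scaledKernel k B b x = 0 := by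
  rw [scaledKernel, hB.eq_zero _ ((lt_div_iff₀ hb).2 hx), mul_zero]

theorem integrable_scaledKernel (hB : HasKernelBound B M ρ) (hb : 0 < b) :
    Integrable (scaledKernel k B b) := by
  have h : IntegrableOn (scaledKernel k B b) (Metric.closedBall 0 (ρ * b)) :=
    Measure.integrableOn_of_bounded (M := M / b ^ k) measure_closedBall_lt_top.ne
      (measurable_scaledKernel hB.measurable).aestronglyMeasurable
      (ae_of_all _ fun x => abs_scaledKernel_le hB hb x)
  refine (integrableOn_iff_integrable_of_support_subset fun x hx => ?_).1 h
  by_contra hx'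
  rw [mem_closedBall_zero_iff, not_le] at hx'
  exact hx (scaledKernel_eq_zero hB hb hx')

theorem scaledKernel_eq_smul (b : ℝ) (hb : 0 < b) (x : E k) :
    scaledKernel k B b x = (1 / b ^ k) * B ‖b⁻¹ • x‖ := by
  rw [scaledKernel, norm_smul, Real.norm_of_nonneg (by positivity), div_eq_inv_mul ‖x‖ b]

theorem integral_comp_scaled (hb : 0 < b) (g : E k → ℝ) :
    ∫ x, (1 / b ^ k) * g (b⁻¹ • x) = ∫ x, g x := by
  rw [integral_const_mul, Measure.integral_comp_inv_smul_of_nonneg _ _ hb.le, finrank_euclideanSpace,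
    Fintype.card_fin, smul_eq_mul, ← mul_assoc, one_div, inv_mul_cancel₀ (by positivity), one_mul]

theorem integral_scaledKernel (hb : 0 < b) :
    ∫ x, scaledKernel k B b x = ∫ x : E k, B ‖x‖ := by
  simp_rw [scaledKernel_eq_smul b hb]
  exact integral_comp_scaled hb fun x => B ‖x‖

theorem integral_abs_scaledKernel (hb : 0 < b) :
    ∫ x, |scaledKernel k B b x| = ∫ x : E k, |B ‖x‖| := by
  simp_rw [scaledKernel_eq_smul b hb, abs_mul, abs_of_nonneg (one_div_nonneg.2 (pow_pos hb k).le)]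
  exact integral_comp_scaled hb fun x => |B ‖x‖|

theorem integral_sq_scaledKernel_le (hB : HasKernelBound B M ρ) (hb : 0 < b) :
    ∫ x, scaledKernel k B b x ^ 2 ≤ M * (∫ x : E k, |B ‖x‖|) / b ^ k := by
  rw [← integral_abs_scaledKernel hb, mul_div_right_comm, ← integral_const_mul]
  refine integral_mono_of_nonneg (ae_of_all _ fun x => sq_nonneg _)
    ((integrable_scaledKernel hB hb).abs.const_mul _) (ae_of_all _ fun x => ?_)
  dsimp only
  rw [← sq_abs, sq]
  gcongr
  exact abs_scaledKernel_le hB hb x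

theorem integrable_kde {N : ℕ} (hB : HasKernelBound B M ρ) (hb : 0 < b) (x : Fin N → E k) :
    Integrable (kde B b x) :=
  (integrable_finsetSum _ fun j _ => (integrable_scaledKernel hB hb).comp_sub_right (x j)).const_mul _

end ScaledKernel

section Smoothed

variable {k : ℕ} {𝒦 : Set (E k)} {B : ℝ → ℝ} {M ρ b : ℝ}

/-- The density of `P` convolved with the rescaled kernel: the mean of the density estimator. -/
noncomputable def smoothed (B : ℝ → ℝ) (b : ℝ) (P : Distr 𝒦) (u : E k) : ℝ :=
  ∫ x, scaledKernel k B b (u - x) ∂P.meas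

theorem measurable_smoothed (hB : Measurable B) :
    Measurable fun z : Distr 𝒦 × E k => smoothed B b z.1 z.2 := by
  have h : StronglyMeasurable
      (Function.uncurry fun (z : Distr 𝒦 × E k) (x : E k) => scaledKernel k B b (z.2 - x)) :=
    ((measurable_scaledKernel hB).comp
      ((measurable_snd.comp measurable_fst).sub measurable_snd)).stronglyMeasurable
  exact (h.integral_kernel_prod_right' (κ := (Distr.kernel 𝒦).prodMkRight (E k))).measurable

theorem abs_smoothed_le (hB : HasKernelBound B M ρ) (hb : 0 < b) (P : Distr 𝒦) (u : E k) :
    |smoothed B b P u| ≤ M / b ^ k := by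
  have h := norm_integral_le_of_norm_le_const (μ := P.meas)
    (f := fun x => scaledKernel k B b (u - x)) (C := M / b ^ k)
    (ae_of_all _ fun _ => abs_scaledKernel_le hB hb _)
  simpa [smoothed] using h

theorem scaledKernel_sub_eq_zero (hB : HasKernelBound B M ρ) (hb : 0 < b) (hb1 : b ≤ 1)
    {u x : E k} (hu : u ∉ Metric.cthickening ρ 𝒦) (hx : x ∈ 𝒦) :
    scaledKernel k B b (u - x) = 0 := by
  refine scaledKernel_eq_zero hB hb ?_
  by_contra h
  rw [not_lt] at h
  refine hu (Metric.mem_cthickening_of_dist_le u x ρ 𝒦 hx ?_)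
  rw [dist_eq_norm]
  exact h.trans (mul_le_of_le_one_right hB.radius_nonneg hb1)

theorem smoothed_eq_zero (hB : HasKernelBound B M ρ) (hb : 0 < b) (hb1 : b ≤ 1)
    (P : Distr 𝒦) {u : E k} (hu : u ∉ Metric.cthickening ρ 𝒦) : smoothed B b P u = 0 := by
  refine integral_eq_zero_of_ae ?_
  have h : ∀ᵐ x ∂P.meas, x ∈ 𝒦 := P.meas_compl
  filter_upwards [h] with x hx
  exact scaledKernel_sub_eq_zero hB hb hb1 hu hx

theorem measure_cthickening_lt_top (h𝒦 : IsCompact 𝒦) (ρ : ℝ) :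
    volume (Metric.cthickening ρ 𝒦) < ∞ :=
  h𝒦.isBounded.cthickening.measure_lt_top

theorem integrable_smoothed (h𝒦 : IsCompact 𝒦) (hB : HasKernelBound B M ρ) (hb : 0 < b)
    (hb1 : b ≤ 1) (P : Distr 𝒦) : Integrable (smoothed B b P) := by
  have h : IntegrableOn (smoothed B b P) (Metric.cthickening ρ 𝒦) :=
    Measure.integrableOn_of_bounded (M := M / b ^ k) (measure_cthickening_lt_top h𝒦 ρ).ne
      ((measurable_smoothed hB.measurable).comp measurable_prodMk_left).aestronglyMeasurable
      (ae_of_all _ fun x => abs_smoothed_le hB hb P x)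
  refine (integrableOn_iff_integrable_of_support_subset fun x hx => ?_).1 h
  by_contra hx'
  exact hx (smoothed_eq_zero hB hb hb1 P hx')

theorem abs_smoothed_sub_le {Λ : ℝ≥0} (hB : HasKernelBound B M ρ) (hb : 0 < b)
    (hint : ∫ x : E k, B ‖x‖ = 1) (P : Distr 𝒦) {p : E k → ℝ} (hp0 : ∀ x, 0 ≤ p x)
    (hpL : LipschitzWith Λ p) (hP : P.meas = volume.withDensity fun x => ENNReal.ofReal (p x))
    (u : E k) :
    |smoothed B b P u - p u| ≤ Λ * (ρ * b) * ∫ x : E k, |B ‖x‖| := by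
  have hpm : Measurable p := hpL.continuous.measurable
  have hS : Integrable fun x => scaledKernel k B b (u - x) :=
    (integrable_scaledKernel hB hb).comp_sub_left u
  have h1 : smoothed B b P u = ∫ x, p x * scaledKernel k B b (u - x) := by
    rw [smoothed, hP, integral_withDensity_eq_integral_toReal_smul hpm.ennreal_ofReal
      (ae_of_all _ fun x => ENNReal.ofReal_lt_top)]
    simp only [ENNReal.toReal_ofReal (hp0 _), smul_eq_mul]
  have h2 : p u = ∫ x, p u * scaledKernel k B b (u - x) := by
    rw [integral_const_mul, integral_sub_left_eq_self (scaledKernel k B b) volume u,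
      integral_scaledKernel hb, hint, mul_one]
  have hle : ∀ x, |(p x - p u) * scaledKernel k B b (u - x)| ≤
      Λ * (ρ * b) * |scaledKernel k B b (u - x)| := fun x => by
    rw [abs_mul]
    by_cases hx : ρ * b < ‖u - x‖
    · simp [scaledKernel_eq_zero hB hb hx]
    · gcongr
      calc |p x - p u| = dist (p x) (p u) := rfl
        _ ≤ Λ * dist x u := hpL.dist_le_mul x u
        _ ≤ Λ * (ρ * b) := by
          rw [dist_comm, dist_eq_norm]
          gcongr
          exact not_lt.1 hx
  have hD : Integrable fun x => (p x - p u) * scaledKernel k B b (u - x) :=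
    (hS.abs.const_mul (Λ * (ρ * b))).mono'
      ((hpm.sub_const _).mul ((measurable_scaledKernel hB.measurable).comp
        (measurable_const.sub measurable_id))).aestronglyMeasurable (ae_of_all _ hle)
  have hI : Integrable fun x => p x * scaledKernel k B b (u - x) := by
    refine (hD.add (hS.const_mul (p u))).congr (ae_of_all _ fun x => ?_)
    simp only [Pi.add_apply]
    ring
  have h3 : smoothed B b P u - p u = ∫ x, (p x - p u) * scaledKernel k B b (u - x) := by
    rw [h1]
    conv_lhs => rw [h2]
    rw [← integral_sub hI (hS.const_mul _)]
    simp only [sub_mul]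
  rw [h3, ← integral_abs_scaledKernel hb, ← integral_const_mul]
  refine abs_integral_le_integral_abs.trans ?_
  rw [← integral_sub_left_eq_self (fun x => Λ * (ρ * b) * |scaledKernel k B b x|) volume u]
  exact integral_mono hD.abs (hS.abs.const_mul _) hle

theorem l1Dist_smoothed_pdf_le {Λ : ℝ≥0} (h𝒦 : IsCompact 𝒦) (hB : HasKernelBound B M ρ)
    (hb : 0 < b) (hb1 : b ≤ 1) (hint : ∫ x : E k, B ‖x‖ = 1) {P : Distr 𝒦}
    (hP : P.HasSmoothDensity Λ) :
    l1Dist (smoothed B b P) P.pdf ≤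
      Λ * ρ * (∫ x : E k, |B ‖x‖|) * volume.real (Metric.cthickening ρ 𝒦) * b := by
  obtain ⟨p, hp0, hpL, hPp⟩ := hP
  have hpdf : P.pdf =ᵐ[volume] p := by
    have h := Measure.rnDeriv_withDensity volume hpL.continuous.measurable.ennreal_ofReal
    rw [← hPp] at h
    filter_upwards [h] with x hx
    rw [Distr.pdf, hx, ENNReal.toReal_ofReal (hp0 x)]
  have hpdf0 : ∀ᵐ x, x ∉ 𝒦 → P.pdf x = 0 := by
    have hm : MeasurableSet 𝒦ᶜ := h𝒦.measurableSet.compl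
    have h0 : ∫ x in 𝒦ᶜ, P.pdf x = 0 := by
      rw [Distr.setIntegral_pdf, measureReal_def, P.meas_compl, ENNReal.toReal_zero]
    rw [integral_eq_zero_iff_of_nonneg (fun x => P.pdf_nonneg x) P.integrable_pdf.integrableOn]
      at h0
    exact (ae_restrict_iff' hm).1 h0
  have hG : volume (Metric.cthickening ρ 𝒦) < ∞ := measure_cthickening_lt_top h𝒦 ρ
  set C := Λ * (ρ * b) * ∫ x : E k, |B ‖x‖| with hC
  have hle : ∀ᵐ u, |smoothed B b P u - P.pdf u| ≤
      (Metric.cthickening ρ 𝒦).indicator (fun _ => C) u := by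
    filter_upwards [hpdf, hpdf0] with u h1 h2
    by_cases hu : u ∈ Metric.cthickening ρ 𝒦
    · rw [indicator_of_mem hu, h1]
      exact abs_smoothed_sub_le hB hb hint P hp0 hpL hPp u
    · have hu' : u ∉ 𝒦 := fun h => hu (Metric.self_subset_cthickening 𝒦 h)
      rw [indicator_of_notMem hu, smoothed_eq_zero hB hb hb1 P hu, h2 hu', sub_zero, abs_zero]
  have hmG : MeasurableSet (Metric.cthickening ρ 𝒦) := Metric.isClosed_cthickening.measurableSet
  calc l1Dist (smoothed B b P) P.pdf
      ≤ ∫ u, (Metric.cthickening ρ 𝒦).indicator (fun _ => C) u :=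
        integral_mono_ae ((integrable_smoothed h𝒦 hB hb hb1 P).sub P.integrable_pdf).abs
          ((integrable_indicator_iff hmG).2 (integrableOn_const hG.ne)) hle
    _ = _ := by
        rw [integral_indicator hmG, setIntegral_const, smul_eq_mul, hC]
        ring

end Smoothed

section SampleMean

variable {k N : ℕ} {𝒦 : Set (E k)} {π : Measure (Distr 𝒦)} {Ω : Type u} [MeasurableSpace Ω]
  {Pr : Measure Ω} {P : Ω → Distr 𝒦} {X : Fin N → Ω → E k}

/-- `P` has law `π` and, given `P`, the points `X j` are i.i.d. with law `P`. -/
structure IsConditionalSample (Pr : Measure Ω) (π : Measure (Distr 𝒦)) (P : Ω → Distr 𝒦)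
    (X : Fin N → Ω → E k) : Prop where
  measurable_P : Measurable P
  measurable_X : ∀ j, Measurable (X j)
  law : ∀ A : Set (Distr 𝒦), MeasurableSet A →
    ∀ S : Fin N → Set (E k), (∀ j, MeasurableSet (S j)) →
      Pr {ω | P ω ∈ A ∧ ∀ j, X j ω ∈ S j} = ∫⁻ p in A, ∏ j, p.meas (S j) ∂π

namespace IsConditionalSample

theorem map_prodMk [IsProbabilityMeasure Pr] [IsProbabilityMeasure π]
    (hX : IsConditionalSample Pr π P X) (j : Fin N) :
    Pr.map (fun ω => (P ω, X j ω)) = π ⊗ₘ Distr.kernel 𝒦 := by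
  have hm : Measurable fun ω => (P ω, X j ω) := hX.measurable_P.prodMk (hX.measurable_X j)
  have := Measure.isProbabilityMeasure_map (μ := Pr) hm.aemeasurable
  refine Measure.ext_prod fun {A S} hA hS => ?_
  have hS' : ∀ l, MeasurableSet (if l = j then S else univ) := fun l => by
    split_ifs
    exacts [hS, MeasurableSet.univ]
  have h := hX.law A hA (fun l => if l = j then S else univ) hS'
  rw [Measure.map_apply hm (hA.prod hS), Measure.compProd_apply_prod hA hS]
  convert h using 2
  · ext ω
    simp only [mem_preimage, mem_prod, mem_ofPred_eq]
    refine and_congr_right fun _ => ⟨fun h l => ?_, fun h => by simpa using h j⟩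
    split_ifs with hl
    · rwa [hl]
    · trivial
  · funext p
    rw [Finset.prod_eq_single j]
    · simp
    · intro l _ hl
      simp [hl]
    · simp

theorem map_prodMk_prodMk [IsProbabilityMeasure Pr] [IsProbabilityMeasure π]
    (hX : IsConditionalSample Pr π P X) {i j : Fin N} (hij : i ≠ j) :
    Pr.map (fun ω => (P ω, X i ω, X j ω)) = π ⊗ₘ (Distr.kernel 𝒦 ×ₖ Distr.kernel 𝒦) := by
  have hm : Measurable fun ω => (P ω, X i ω, X j ω) :=
    hX.measurable_P.prodMk ((hX.measurable_X i).prodMk (hX.measurable_X j))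
  have := Measure.isProbabilityMeasure_map (μ := Pr) hm.aemeasurable
  refine Measure.ext_prod₃ fun {A S T} hA hS hT => ?_
  have hS' : ∀ l, MeasurableSet (if l = i then S else if l = j then T else univ) := fun l => by
    split_ifs
    exacts [hS, hT, MeasurableSet.univ]
  have h := hX.law A hA (fun l => if l = i then S else if l = j then T else univ) hS'
  rw [Measure.map_apply hm (hA.prod (hS.prod hT)), Measure.compProd_apply_prod hA (hS.prod hT)]
  convert h using 2
  · ext ω
    simp only [mem_preimage, mem_prod, mem_ofPred_eq]
    refine and_congr_right fun _ => ⟨fun h l => ?_, fun h => ⟨by simpa using h i, ?_⟩⟩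
    · split_ifs with hl hl'
      · rw [hl]; exact h.1
      · rw [hl']; exact h.2
      · trivial
    · simpa [hij.symm] using h j
  · funext p
    rw [Kernel.prod_apply, Measure.prod_prod, Finset.prod_eq_mul i j hij]
    · simp [hij.symm]
    · intro l _ hl
      simp [hl.1, hl.2]
    · simp
    · simp

theorem ae_mem [IsProbabilityMeasure Pr] [IsProbabilityMeasure π]
    (hX : IsConditionalSample Pr π P X) (h𝒦 : MeasurableSet 𝒦) :
    ∀ᵐ ω ∂Pr, ∀ j, X j ω ∈ 𝒦 := by
  rw [ae_all_iff]
  intro j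
  have hm : Measurable fun ω => (P ω, X j ω) := hX.measurable_P.prodMk (hX.measurable_X j)
  have h : ∀ᵐ z ∂(Pr.map fun ω => (P ω, X j ω)), z.2 ∈ 𝒦 := by
    rw [hX.map_prodMk]
    refine (ae_iff.2 ?_)
    have hS : {z : Distr 𝒦 × E k | z.2 ∉ 𝒦} = univ ×ˢ 𝒦ᶜ := by ext; simp
    rw [hS, Measure.compProd_apply_prod MeasurableSet.univ h𝒦.compl]
    simp [Distr.meas_compl]
  exact ae_of_ae_map hm.aemeasurable h

theorem integral_mul_eq_zero [IsProbabilityMeasure Pr] [IsProbabilityMeasure π]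
    (hX : IsConditionalSample Pr π P X) {g : E k → ℝ} (hg : Measurable g) {C : ℝ}
    (hC : ∀ x, |g x| ≤ C) {i j : Fin N} (hij : i ≠ j) :
    ∫ ω, (g (X i ω) - ∫ x, g x ∂(P ω).meas) * (g (X j ω) - ∫ x, g x ∂(P ω).meas) ∂Pr = 0 := by
  have he : Measurable fun p : Distr 𝒦 => ∫ x, g x ∂p.meas :=
    (hg.stronglyMeasurable.integral_kernel (κ := Distr.kernel 𝒦)).measurable
  have heC : ∀ p : Distr 𝒦, |∫ x, g x ∂p.meas| ≤ C := fun p => by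
    have h := norm_integral_le_of_norm_le_const (μ := p.meas) (f := g) (C := C)
      (ae_of_all _ fun x => hC x)
    simpa using h
  have hm : Measurable fun ω => (P ω, X i ω, X j ω) :=
    hX.measurable_P.prodMk ((hX.measurable_X i).prodMk (hX.measurable_X j))
  have hF : Measurable fun z : Distr 𝒦 × E k × E k =>
      (g z.2.1 - ∫ x, g x ∂z.1.meas) * (g z.2.2 - ∫ x, g x ∂z.1.meas) :=
    ((hg.comp (measurable_fst.comp measurable_snd)).sub (he.comp measurable_fst)).mul
      ((hg.comp (measurable_snd.comp measurable_snd)).sub (he.comp measurable_fst))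
  have h := integral_map (μ := Pr) hm.aemeasurable hF.aestronglyMeasurable
  rw [← h, hX.map_prodMk_prodMk hij, Measure.integral_compProd]
  · refine integral_eq_zero_of_ae (ae_of_all _ fun p => ?_)
    have h0 : ∫ x, (g x - ∫ x, g x ∂p.meas) ∂p.meas = 0 := by
      rw [integral_sub (Integrable.of_bound hg.aestronglyMeasurable C (ae_of_all _ hC))
        (integrable_const _)]
      simp
    dsimp only
    rw [Kernel.prod_apply, Distr.kernel_apply,
      integral_prod_mul (fun x => g x - ∫ x, g x ∂p.meas) (fun x => g x - ∫ x, g x ∂p.meas), h0,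
      zero_mul]
    rfl
  · refine Integrable.of_bound hF.aestronglyMeasurable ((C + C) * (C + C))
      (ae_of_all _ fun z => ?_)
    rw [norm_mul]
    have h1 : ∀ x, ‖g x - ∫ x, g x ∂z.1.meas‖ ≤ C + C := fun x =>
      (norm_sub_le _ _).trans (add_le_add (hC x) (heC _))
    exact mul_le_mul (h1 _) (h1 _) (norm_nonneg _) ((norm_nonneg _).trans (h1 z.2.1))

theorem integral_sq_le [IsProbabilityMeasure Pr] [IsProbabilityMeasure π]
    (hX : IsConditionalSample Pr π P X) {g : E k → ℝ} (hg : Measurable g) {C : ℝ}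
    (hC : ∀ x, |g x| ≤ C) (j : Fin N) :
    ∫ ω, (g (X j ω) - ∫ x, g x ∂(P ω).meas) ^ 2 ∂Pr ≤ ∫ ω, g (X j ω) ^ 2 ∂Pr := by
  have he : Measurable fun p : Distr 𝒦 => ∫ x, g x ∂p.meas :=
    (hg.stronglyMeasurable.integral_kernel (κ := Distr.kernel 𝒦)).measurable
  have heC : ∀ p : Distr 𝒦, |∫ x, g x ∂p.meas| ≤ C := fun p => by
    have h := norm_integral_le_of_norm_le_const (μ := p.meas) (f := g) (C := C)
      (ae_of_all _ fun x => hC x)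
    simpa using h
  have hm : Measurable fun ω => (P ω, X j ω) := hX.measurable_P.prodMk (hX.measurable_X j)
  have hF : Measurable fun z : Distr 𝒦 × E k => (g z.2 - ∫ x, g x ∂z.1.meas) ^ 2 :=
    ((hg.comp measurable_snd).sub (he.comp measurable_fst)).pow_const 2
  have hF' : Measurable fun z : Distr 𝒦 × E k => g z.2 ^ 2 := (hg.comp measurable_snd).pow_const 2
  have hFi : Integrable (fun z : Distr 𝒦 × E k => (g z.2 - ∫ x, g x ∂z.1.meas) ^ 2)
      (π ⊗ₘ Distr.kernel 𝒦) :=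
    Integrable.of_bound hF.aestronglyMeasurable ((C + C) ^ 2) (ae_of_all _ fun z => by
      rw [norm_pow]
      gcongr
      exact (norm_sub_le _ _).trans (add_le_add (hC _) (heC _)))
  have hFi' : Integrable (fun z : Distr 𝒦 × E k => g z.2 ^ 2) (π ⊗ₘ Distr.kernel 𝒦) :=
    Integrable.of_bound hF'.aestronglyMeasurable (C ^ 2) (ae_of_all _ fun z => by
      rw [norm_pow]
      gcongr
      exact hC _)
  rw [← integral_map (μ := Pr) hm.aemeasurable hF.aestronglyMeasurable,
    ← integral_map (μ := Pr) hm.aemeasurable hF'.aestronglyMeasurable, hX.map_prodMk,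
    Measure.integral_compProd hFi, Measure.integral_compProd hFi']
  refine integral_mono hFi.integral_compProd hFi'.integral_compProd fun p => ?_
  have h := variance_le_expectation_sq (μ := p.meas) hg.aestronglyMeasurable
  rw [variance_eq_integral hg.aemeasurable] at h
  exact h

theorem integral_sq_mean_sub_le [IsProbabilityMeasure Pr] [IsProbabilityMeasure π]
    (hX : IsConditionalSample Pr π P X) {g : E k → ℝ} (hg : Measurable g) {C : ℝ}
    (hC : ∀ x, |g x| ≤ C) (hN : 1 ≤ N) :
    ∫ ω, ((1 / (N : ℝ)) * ∑ j, g (X j ω) - ∫ x, g x ∂(P ω).meas) ^ 2 ∂Pr ≤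
      (1 / (N : ℝ)) ^ 2 * ∑ j, ∫ ω, g (X j ω) ^ 2 ∂Pr := by
  have he : Measurable fun p : Distr 𝒦 => ∫ x, g x ∂p.meas :=
    (hg.stronglyMeasurable.integral_kernel (κ := Distr.kernel 𝒦)).measurable
  have heC : ∀ p : Distr 𝒦, |∫ x, g x ∂p.meas| ≤ C := fun p => by
    have h := norm_integral_le_of_norm_le_const (μ := p.meas) (f := g) (C := C)
      (ae_of_all _ fun x => hC x)
    simpa using h
  have hξm : ∀ j, Measurable fun ω => g (X j ω) - ∫ x, g x ∂(P ω).meas := fun j =>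
    (hg.comp (hX.measurable_X j)).sub (he.comp hX.measurable_P)
  have hint : ∀ i j, Integrable (fun ω => (g (X i ω) - ∫ x, g x ∂(P ω).meas) *
      (g (X j ω) - ∫ x, g x ∂(P ω).meas)) Pr := fun i j => by
    refine Integrable.of_bound ((hξm i).mul (hξm j)).aestronglyMeasurable ((C + C) * (C + C))
      (ae_of_all _ fun ω => ?_)
    have h1 : ∀ x, ‖g x - ∫ x, g x ∂(P ω).meas‖ ≤ C + C := fun x =>
      (norm_sub_le _ _).trans (add_le_add (hC x) (heC _))
    rw [norm_mul]
    exact mul_le_mul (h1 _) (h1 _) (norm_nonneg _) ((norm_nonneg _).trans (h1 (X i ω)))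
  have hN0 : (N : ℝ) ≠ 0 := by positivity
  have hsq : ∀ ω, ((1 / (N : ℝ)) * ∑ j, g (X j ω) - ∫ x, g x ∂(P ω).meas) ^ 2 =
      (1 / (N : ℝ)) ^ 2 * ∑ i, ∑ j, (g (X i ω) - ∫ x, g x ∂(P ω).meas) *
        (g (X j ω) - ∫ x, g x ∂(P ω).meas) := fun ω => by
    rw [← Finset.sum_mul_sum, ← sq, ← mul_pow, Finset.sum_sub_distrib]
    congr 1
    simp only [Finset.sum_const, Finset.card_univ, Fintype.card_fin, nsmul_eq_mul]
    field_simp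
  simp_rw [hsq]
  rw [integral_const_mul,
    integral_finsetSum _ fun i _ => integrable_finsetSum _ fun j _ => hint i j]
  refine mul_le_mul_of_nonneg_left (Finset.sum_le_sum fun i _ => ?_) (by positivity)
  rw [integral_finsetSum _ fun j _ => hint i j, Finset.sum_eq_single i]
  · simp_rw [← sq]
    exact hX.integral_sq_le hg hC i
  · intro j _ hj
    exact hX.integral_mul_eq_zero hg hC hj.symm
  · simp

end IsConditionalSample

end SampleMean

section KdeError

variable {k N : ℕ} {𝒦 : Set (E k)} {π : Measure (Distr 𝒦)} {Ω : Type u} [MeasurableSpace Ω]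
  {Pr : Measure Ω} {P : Ω → Distr 𝒦} {X : Fin N → Ω → E k} {B : ℝ → ℝ} {M ρ b : ℝ}

theorem measurable_kde (hB : Measurable B) (hX : ∀ j, Measurable (X j)) :
    Measurable fun z : Ω × E k => kde B b (fun j => X j z.1) z.2 := by
  simp only [kde_eq]
  exact (Finset.measurable_fun_sum _ fun j _ => (measurable_scaledKernel hB).comp
    (measurable_snd.sub ((hX j).comp measurable_fst))).const_mul _

theorem measurable_kde_sub_smoothed (hB : Measurable B) (hX : IsConditionalSample Pr π P X) :
    Measurable fun z : Ω × E k => kde B b (fun j => X j z.1) z.2 - smoothed B b (P z.1) z.2 :=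
  (measurable_kde hB hX.measurable_X).sub ((measurable_smoothed hB).comp
    ((hX.measurable_P.comp measurable_fst).prodMk measurable_snd))

theorem measurable_l1Dist {F G : Ω × E k → ℝ} (hF : Measurable F) (hG : Measurable G) :
    Measurable fun ω => l1Dist (fun u => F (ω, u)) fun u => G (ω, u) :=
  ((hF.sub hG).norm.stronglyMeasurable.integral_prod_right').measurable

theorem abs_kde_le (hB : HasKernelBound B M ρ) (hb : 0 < b) (hN : 1 ≤ N) (x : Fin N → E k)
    (u : E k) : |kde B b x u| ≤ M / b ^ k := by
  have hN0 : (0 : ℝ) < N := by exact_mod_cast hN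
  rw [kde_eq, abs_mul, abs_of_nonneg (by positivity), one_div_mul_eq_div, div_le_iff₀' hN0]
  calc |∑ j, scaledKernel k B b (u - x j)| ≤ ∑ j, |scaledKernel k B b (u - x j)| :=
        Finset.abs_sum_le_sum_abs _ _
    _ ≤ ∑ _j : Fin N, M / b ^ k := Finset.sum_le_sum fun j _ => abs_scaledKernel_le hB hb _
    _ = _ := by simp

theorem integral_sq_kde_sub_smoothed_le [IsProbabilityMeasure Pr] [IsProbabilityMeasure π]
    (hX : IsConditionalSample Pr π P X) (hB : HasKernelBound B M ρ) (hb : 0 < b) (hN : 1 ≤ N)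
    {G : Set (E k)} (hG : volume G ≠ ∞) :
    ∫ z, (kde B b (fun j => X j z.1) z.2 - smoothed B b (P z.1) z.2) ^ 2
        ∂(Pr.prod (volume.restrict G)) ≤ M * (∫ x : E k, |B ‖x‖|) / (N * b ^ k) := by
  have : IsFiniteMeasure (volume.restrict G) := isFiniteMeasure_restrict.2 hG
  have hN0 : (0 : ℝ) < N := by exact_mod_cast hN
  have hMb : 0 ≤ M / b ^ k := div_nonneg hB.bound_nonneg (by positivity)
  have hF := measurable_kde_sub_smoothed (b := b) hB.measurable hX
  have hFi : Integrable (fun z : Ω × E k =>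
      (kde B b (fun j => X j z.1) z.2 - smoothed B b (P z.1) z.2) ^ 2)
      (Pr.prod (volume.restrict G)) :=
    Integrable.of_bound (hF.pow_const 2).aestronglyMeasurable ((M / b ^ k + M / b ^ k) ^ 2)
      (ae_of_all _ fun z => by
        rw [norm_pow]
        gcongr
        exact (norm_sub_le _ _).trans
          (add_le_add (abs_kde_le hB hb hN _ _) (abs_smoothed_le hB hb _ _)))
  have hS : ∀ j, Measurable fun z : Ω × E k => scaledKernel k B b (z.2 - X j z.1) ^ 2 := fun j =>
    ((measurable_scaledKernel hB.measurable).comp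
      (measurable_snd.sub ((hX.measurable_X j).comp measurable_fst))).pow_const 2
  have hSi : ∀ j, Integrable (fun z : Ω × E k => scaledKernel k B b (z.2 - X j z.1) ^ 2)
      (Pr.prod (volume.restrict G)) := fun j =>
    Integrable.of_bound (hS j).aestronglyMeasurable ((M / b ^ k) ^ 2) (ae_of_all _ fun z => by
      rw [norm_pow]
      gcongr
      exact abs_scaledKernel_le hB hb _)
  have hsq : Integrable fun x : E k => scaledKernel k B b x ^ 2 := by
    refine ((integrable_scaledKernel hB hb).abs.const_mul (M / b ^ k)).mono'
      ((measurable_scaledKernel hB.measurable).pow_const 2).aestronglyMeasurable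
      (ae_of_all _ fun x => ?_)
    rw [norm_pow, sq, Real.norm_eq_abs]
    gcongr
    exact abs_scaledKernel_le hB hb x
  calc ∫ z, (kde B b (fun j => X j z.1) z.2 - smoothed B b (P z.1) z.2) ^ 2
        ∂(Pr.prod (volume.restrict G))
      = ∫ u in G, ∫ ω, (kde B b (fun j => X j ω) u - smoothed B b (P ω) u) ^ 2 ∂Pr :=
        integral_prod_symm _ hFi
    _ ≤ ∫ u in G, (1 / (N : ℝ)) ^ 2 * ∑ j, ∫ ω, scaledKernel k B b (u - X j ω) ^ 2 ∂Pr := by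
        refine integral_mono hFi.integral_prod_right ?_ fun u => ?_
        · exact (integrable_finsetSum _ fun j _ => (hSi j).integral_prod_right).const_mul _
        · exact hX.integral_sq_mean_sub_le ((measurable_scaledKernel hB.measurable).comp
            (measurable_const.sub measurable_id)) (fun x => abs_scaledKernel_le hB hb _) hN
    _ = (1 / (N : ℝ)) ^ 2 * ∑ j, ∫ ω, (∫ u in G, scaledKernel k B b (u - X j ω) ^ 2) ∂Pr := by
        rw [integral_const_mul, integral_finsetSum _ fun j _ => (hSi j).integral_prod_right]
        congr 2 with j
        rw [← integral_prod_symm _ (hSi j), integral_prod _ (hSi j)]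
    _ ≤ (1 / (N : ℝ)) ^ 2 * ∑ _j : Fin N, M * (∫ x : E k, |B ‖x‖|) / b ^ k := by
        refine mul_le_mul_of_nonneg_left (Finset.sum_le_sum fun j _ => ?_) (by positivity)
        have h : ∀ ω, ∫ u in G, scaledKernel k B b (u - X j ω) ^ 2 ≤
            M * (∫ x : E k, |B ‖x‖|) / b ^ k := fun ω => by
          refine le_trans ?_ (integral_sq_scaledKernel_le hB hb)
          rw [← integral_sub_right_eq_self (fun x => scaledKernel k B b x ^ 2) (X j ω)]
          exact setIntegral_le_integral (hsq.comp_sub_right (X j ω))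
            (ae_of_all _ fun u => sq_nonneg _)
        refine (integral_mono (hSi j).integral_prod_left (integrable_const _) h).trans_eq ?_
        simp
    _ = _ := by
        simp only [Finset.sum_const, Finset.card_univ, Fintype.card_fin, nsmul_eq_mul]
        field_simp

theorem integral_l1Dist_kde_smoothed_le [IsProbabilityMeasure Pr] [IsProbabilityMeasure π]
    (h𝒦 : IsCompact 𝒦) (hX : IsConditionalSample Pr π P X) (hB : HasKernelBound B M ρ)
    (hb : 0 < b) (hb1 : b ≤ 1) (hN : 1 ≤ N) (hbN : 1 / (N * b ^ k) ≤ b ^ 2) :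
    Integrable (fun ω => l1Dist (kde B b fun j => X j ω) (smoothed B b (P ω))) Pr ∧
    ∫ ω, l1Dist (kde B b fun j => X j ω) (smoothed B b (P ω)) ∂Pr ≤
      (volume.real (Metric.cthickening ρ 𝒦) + M * ∫ x : E k, |B ‖x‖|) / 2 * b := by
  set G := Metric.cthickening ρ 𝒦 with hGdef
  have hG : volume G < ∞ := measure_cthickening_lt_top h𝒦 ρ
  have : IsFiniteMeasure (volume.restrict G) := isFiniteMeasure_restrict.2 hG.ne
  have hN0 : (0 : ℝ) < N := by exact_mod_cast hN
  have hF := measurable_kde_sub_smoothed (b := b) hB.measurable hX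
  have hMb : 0 ≤ M / b ^ k := div_nonneg hB.bound_nonneg (by positivity)
  have hbd : ∀ z : Ω × E k, ‖kde B b (fun j => X j z.1) z.2 - smoothed B b (P z.1) z.2‖ ≤
      M / b ^ k + M / b ^ k := fun z => (norm_sub_le _ _).trans
        (add_le_add (abs_kde_le hB hb hN _ _) (abs_smoothed_le hB hb _ _))
  have hFi : Integrable (fun z : Ω × E k =>
      (kde B b (fun j => X j z.1) z.2 - smoothed B b (P z.1) z.2))
      (Pr.prod (volume.restrict G)) :=
    Integrable.of_bound hF.aestronglyMeasurable (M / b ^ k + M / b ^ k) (ae_of_all _ hbd)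
  have hFi2 : Integrable (fun z : Ω × E k =>
      (kde B b (fun j => X j z.1) z.2 - smoothed B b (P z.1) z.2) ^ 2)
      (Pr.prod (volume.restrict G)) :=
    Integrable.of_bound (hF.pow_const 2).aestronglyMeasurable ((M / b ^ k + M / b ^ k) ^ 2)
      (ae_of_all _ fun z => by
        rw [norm_pow]
        gcongr
        exact hbd z)
  have hmem := hX.ae_mem h𝒦.measurableSet
  have heq : (fun ω => l1Dist (kde B b fun j => X j ω) (smoothed B b (P ω))) =ᵐ[Pr]
      fun ω => ∫ u in G, |kde B b (fun j => X j ω) u - smoothed B b (P ω) u| := by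
    filter_upwards [hmem] with ω hω
    refine (setIntegral_eq_integral_of_forall_compl_eq_zero fun u hu => ?_).symm
    rw [smoothed_eq_zero hB hb hb1 _ hu, kde_eq, Finset.sum_eq_zero, mul_zero, sub_zero, abs_zero]
    exact fun j _ => scaledKernel_sub_eq_zero hB hb hb1 hu (hω j)
  refine ⟨(hFi.abs.integral_prod_left).congr heq.symm, ?_⟩
  rw [integral_congr_ae heq]
  calc ∫ ω, (∫ u in G, |kde B b (fun j => X j ω) u - smoothed B b (P ω) u|) ∂Pr
      = ∫ z, |kde B b (fun j => X j z.1) z.2 - smoothed B b (P z.1) z.2|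
          ∂(Pr.prod (volume.restrict G)) := (integral_prod _ hFi.abs).symm
    _ ≤ ∫ z, (b / 2 + 1 / (2 * b) *
          (kde B b (fun j => X j z.1) z.2 - smoothed B b (P z.1) z.2) ^ 2)
          ∂(Pr.prod (volume.restrict G)) := by
        refine integral_mono hFi.abs ((integrable_const _).add (hFi2.const_mul _)) fun z => ?_
        dsimp only
        rw [← sq_abs (_ - _)]
        set t := |kde B b (fun j => X j z.1) z.2 - smoothed B b (P z.1) z.2|
        rw [show b / 2 + 1 / (2 * b) * t ^ 2 = (b ^ 2 + t ^ 2) / (2 * b) by field_simp,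
          le_div_iff₀ (by positivity)]
        nlinarith [sq_nonneg (b - t)]
    _ = b / 2 * volume.real G + 1 / (2 * b) *
          ∫ z, (kde B b (fun j => X j z.1) z.2 - smoothed B b (P z.1) z.2) ^ 2
          ∂(Pr.prod (volume.restrict G)) := by
        rw [integral_add (integrable_const _) (hFi2.const_mul _), integral_const_mul,
          integral_const, smul_eq_mul, mul_comm (b / 2)]
        congr 2
        simp [measureReal_def, ← univ_prod_univ, Measure.prod_prod]
    _ ≤ b / 2 * volume.real G + 1 / (2 * b) * (M * (∫ x : E k, |B ‖x‖|) * b ^ 2) := by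
        gcongr
        refine (integral_sq_kde_sub_smoothed_le hX hB hb hN hG.ne).trans ?_
        rw [div_eq_mul_one_div]
        have h0 : 0 ≤ M * ∫ x : E k, |B ‖x‖| :=
          mul_nonneg hB.bound_nonneg (integral_nonneg fun _ => abs_nonneg _)
        gcongr
    _ = _ := by
        field_simp

end KdeError

section Fluctuation

variable {Ω : Type u} [MeasurableSpace Ω] {Pr : Measure Ω}

theorem indepFun_last_castSucc {m : ℕ} {α : Type*} [MeasurableSpace α]
    {Z : Fin (m + 1) → Ω → α} (hZ : ∀ i, Measurable (Z i)) (hind : iIndepFun Z Pr) :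
    IndepFun (Z (Fin.last m)) (fun ω (i : Fin m) => Z i.castSucc ω) Pr := by
  have hd : Disjoint {Fin.last m} (Finset.univ.map (Fin.castSuccEmb (n := m))) := by
    rw [Finset.disjoint_singleton_left]
    simp [Fin.castSucc_ne_last]
  have h := hind.indepFun_finset {Fin.last m} (Finset.univ.map (Fin.castSuccEmb (n := m))) hd hZ
  have hφ : Measurable fun z : (({Fin.last m} : Finset (Fin (m + 1))) → α) =>
      z ⟨Fin.last m, by simp⟩ := measurable_pi_apply _
  have hψ : Measurable fun (z : (Finset.univ.map (Fin.castSuccEmb (n := m)) : Finset _) → α)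
      (i : Fin m) => z ⟨i.castSucc, by simp⟩ :=
    measurable_pi_lambda _ fun i => measurable_pi_apply _
  exact h.comp hφ hψ

theorem integral_sq_sum_eq [IsProbabilityMeasure Pr] {m : ℕ} {G : Fin m → Ω → ℝ}
    (hG : ∀ i, MemLp (G i) 2 Pr) (hind : iIndepFun G Pr) (h0 : ∀ i, ∫ ω, G i ω ∂Pr = 0) :
    ∫ ω, (∑ i, G i ω) ^ 2 ∂Pr = ∑ i, ∫ ω, G i ω ^ 2 ∂Pr := by
  have h := IndepFun.variance_sum (s := Finset.univ) (fun i _ => hG i)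
    fun i _ j _ hij => hind.indepFun hij
  have hm : AEMeasurable (∑ i, G i) Pr :=
    Finset.aemeasurable_sum _ fun i _ => (hG i).aestronglyMeasurable.aemeasurable
  rw [variance_of_integral_eq_zero hm] at h
  · simp only [Finset.sum_apply] at h
    rw [h]
    exact Finset.sum_congr rfl fun i _ =>
      variance_of_integral_eq_zero (hG i).aestronglyMeasurable.aemeasurable (h0 i)
  · simp only [Finset.sum_apply]
    rw [integral_finsetSum _ fun i _ => (hG i).integrable one_le_two]
    exact Finset.sum_eq_zero fun i _ => h0 i

theorem lintegral_sq_weighted_sum_le [IsProbabilityMeasure Pr] {m : ℕ} {α τ : Type*}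
    [MeasurableSpace α] [MeasurableSpace τ] {Z : Fin (m + 1) → Ω → α}
    (hZ : ∀ i, Measurable (Z i)) (hind : iIndepFun Z Pr) {p : α → τ} (hp : Measurable p)
    {π : Measure τ} (hπ : Pr.map (fun ω => p (Z (Fin.last m) ω)) = π) {g : τ → α → ℝ}
    (hg : Measurable fun z : τ × α => g z.1 z.2) {w : τ → ℝ} (hw : Measurable w) {V : ℝ}
    (h : ∀ᵐ s ∂π, ∀ i : Fin m, MemLp (fun ω => g s (Z i.castSucc ω)) 2 Pr ∧
      ∫ ω, g s (Z i.castSucc ω) ∂Pr = 0 ∧ w s ^ 2 * ∫ ω, g s (Z i.castSucc ω) ^ 2 ∂Pr ≤ V) :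
    ∫⁻ ω, ENNReal.ofReal ((w (p (Z (Fin.last m) ω)) *
      ∑ i : Fin m, g (p (Z (Fin.last m) ω)) (Z i.castSucc ω)) ^ 2) ∂Pr ≤
      ENNReal.ofReal (m * V) := by
  have hlast : Measurable fun ω => p (Z (Fin.last m) ω) := hp.comp (hZ _)
  have hinit : Measurable fun ω (i : Fin m) => Z i.castSucc ω :=
    measurable_pi_lambda _ fun i => hZ _
  have hi : IndepFun (fun ω => p (Z (Fin.last m) ω)) (fun ω (i : Fin m) => Z i.castSucc ω) Pr :=
    (indepFun_last_castSucc hZ hind).comp hp measurable_id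
  have hmap := (indepFun_iff_map_prod_eq_prod_map_map hlast.aemeasurable hinit.aemeasurable).1 hi
  have hgs : ∀ s, Measurable (g s) := fun s => hg.comp measurable_prodMk_left
  have hF : Measurable fun z : τ × (Fin m → α) =>
      ENNReal.ofReal ((w z.1 * ∑ i : Fin m, g z.1 (z.2 i)) ^ 2) := by
    refine (((hw.comp measurable_fst).mul
      (Finset.measurable_fun_sum _ fun i _ => ?_)).pow_const 2).ennreal_ofReal
    exact hg.comp (measurable_fst.prodMk ((measurable_pi_apply i).comp measurable_snd))
  have hπp : IsProbabilityMeasure π := by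
    rw [← hπ]
    exact Measure.isProbabilityMeasure_map hlast.aemeasurable
  have hτp := Measure.isProbabilityMeasure_map (μ := Pr) hinit.aemeasurable
  have h1 := lintegral_map (μ := Pr) hF (hlast.prodMk hinit)
  rw [← h1, hmap, hπ, lintegral_prod _ hF.aemeasurable]
  calc _ ≤ ∫⁻ _s, ENNReal.ofReal (m * V) ∂π := ?_
    _ = _ := by simp
  refine lintegral_mono_ae ?_
  filter_upwards [h] with s hs
  have h2 := lintegral_map (μ := Pr) (hF.comp (measurable_prodMk_left (x := s))) hinit
  simp only [Function.comp_apply] at h2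
  rw [h2]
  have hsum : MemLp (fun ω => ∑ i : Fin m, g s (Z i.castSucc ω)) 2 Pr :=
    memLp_finsetSum _ fun i _ => (hs i).1
  have hsq := (hsum.const_mul (w s)).integrable_sq
  rw [← ofReal_integral_eq_lintegral_ofReal hsq (ae_of_all _ fun ω => sq_nonneg _)]
  refine ENNReal.ofReal_le_ofReal ?_
  have hind' : iIndepFun (fun (i : Fin m) ω => g s (Z i.castSucc ω)) Pr :=
    (hind.precomp (Fin.castSucc_injective m)).comp (fun _ => g s) fun _ => hgs s
  simp_rw [mul_pow]
  rw [integral_const_mul, integral_sq_sum_eq (fun i => (hs i).1) hind' fun i => (hs i).2.1,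
    Finset.mul_sum]
  refine (Finset.sum_le_sum fun i _ => (hs i).2.2).trans_eq ?_
  simp

theorem integral_abs_le_sqrt [IsProbabilityMeasure Pr] {W : Ω → ℝ} (hW : Measurable W) {A : ℝ}
    (hA : 0 < A) (h : ∫⁻ ω, ENNReal.ofReal (W ω ^ 2) ∂Pr ≤ ENNReal.ofReal A) :
    Integrable (fun ω => |W ω|) Pr ∧ ∫ ω, |W ω| ∂Pr ≤ √A := by
  have hsq : Integrable (fun ω => W ω ^ 2) Pr := by
    rw [← lintegral_ofReal_ne_top_iff_integrable (hW.pow_const 2).aestronglyMeasurable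
      (ae_of_all _ fun ω => sq_nonneg _)]
    exact (h.trans_lt ENNReal.ofReal_lt_top).ne
  have hle : ∫ ω, W ω ^ 2 ∂Pr ≤ A := by
    rw [← ofReal_integral_eq_lintegral_ofReal hsq (ae_of_all _ fun ω => sq_nonneg _)] at h
    exact (ENNReal.ofReal_le_ofReal_iff hA.le).1 h
  have ht := Real.sqrt_pos.2 hA
  have hst := Real.sq_sqrt hA.le
  set t := √A
  have hpt : ∀ x : ℝ, |x| ≤ t / 2 + 1 / (2 * t) * x ^ 2 := fun x => by
    rw [← sq_abs x, show t / 2 + 1 / (2 * t) * |x| ^ 2 = (t ^ 2 + |x| ^ 2) / (2 * t) by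
      field_simp, le_div_iff₀ (by positivity)]
    nlinarith [sq_nonneg (t - |x|)]
  have hint : Integrable (fun ω => t / 2 + 1 / (2 * t) * W ω ^ 2) Pr :=
    (integrable_const _).add (hsq.const_mul _)
  have hWi : Integrable (fun ω => |W ω|) Pr :=
    hint.mono' hW.abs.aestronglyMeasurable (ae_of_all _ fun ω => by
      rw [Real.norm_eq_abs, abs_abs]
      exact hpt _)
  refine ⟨hWi, (integral_mono hWi hint fun ω => hpt _).trans ?_⟩
  rw [integral_add (integrable_const _) (hsq.const_mul _), integral_const_mul]
  simp only [integral_const, probReal_univ, one_smul]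
  calc t / 2 + 1 / (2 * t) * ∫ ω, W ω ^ 2 ∂Pr ≤ t / 2 + 1 / (2 * t) * t ^ 2 := by
        rw [hst]
        gcongr
    _ = t := by field_simp; ring

end Fluctuation

section Noise

variable {Ω : Type u} [MeasurableSpace Ω] {Pr : Measure Ω}

theorem integral_mul_comp_eq_zero [IsProbabilityMeasure Pr] {τ : Type*} [mτ : MeasurableSpace τ]
    {P : Ω → τ} (hP : Measurable P) {μ : Ω → ℝ} (hμ : Integrable μ Pr)
    (h0 : Pr[μ | MeasurableSpace.comap P mτ] =ᵐ[Pr] 0) {φ : τ → ℝ} (hφ : Measurable φ) {C : ℝ}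
    (hC : ∀ p, |φ p| ≤ C) : ∫ ω, φ (P ω) * μ ω ∂Pr = 0 := by
  have hsm : StronglyMeasurable[MeasurableSpace.comap P mτ] fun ω => φ (P ω) :=
    (hφ.comp (comap_measurable P)).stronglyMeasurable
  have h := condExp_stronglyMeasurable_mul_of_bound hP.comap_le hsm hμ C
    (ae_of_all _ fun ω => hC (P ω))
  have h1 := integral_condExp (μ := Pr) (f := (fun ω => φ (P ω)) * μ) hP.comap_le
  change ∫ ω, ((fun ω => φ (P ω)) * μ) ω ∂Pr = 0
  rw [← h1]
  refine integral_eq_zero_of_ae ?_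
  filter_upwards [h, h0] with ω h2 h3
  rw [h2, Pi.mul_apply, h3, Pi.zero_apply, mul_zero]

end Noise

section RegressionKernel

variable {K : ℝ → ℝ} {LK : ℝ≥0} {Klow r R : ℝ}

namespace IsRegressionKernel

theorem tendsto_zero (hK : IsRegressionKernel K LK Klow r R) :
    Filter.Tendsto K (nhdsWithin 0 (Ioi 0)) (nhds (K 0)) :=
  (hK.lipschitz.continuousOn 0 self_mem_Ici).mono Ioi_subset_Ici_self

theorem le_one (hK : IsRegressionKernel K LK Klow r R) {x : ℝ} (hx : 0 ≤ x) : K x ≤ 1 := by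
  have h : ∀ x, 0 < x → K x ≤ 1 := fun x hx =>
    (hK.upper x hx).trans (indicator_le_self' (fun _ _ => zero_le_one) x)
  rcases hx.eq_or_lt with rfl | hx
  · exact le_of_tendsto hK.tendsto_zero (Filter.eventually_of_mem self_mem_nhdsWithin h)
  · exact h x hx

theorem le_of_le (hK : IsRegressionKernel K LK Klow r R) {x : ℝ} (hx : 0 ≤ x) (hxr : x ≤ r) :
    Klow ≤ K x := by
  have h : ∀ x ∈ Ioc 0 r, Klow ≤ K x := fun x hx => by
    have h := hK.lower x hx.1
    rwa [indicator_of_mem, Pi.one_apply, mul_one] at h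
    rw [mem_closedBall_zero_iff, Real.norm_of_nonneg hx.1.le]
    exact hx.2
  rcases hx.eq_or_lt with rfl | hx
  · exact ge_of_tendsto hK.tendsto_zero
      (Filter.eventually_of_mem (Ioc_mem_nhdsGT hK.r_pos) h)
  · exact h x ⟨hx, hxr⟩

theorem R_pos (hK : IsRegressionKernel K LK Klow r R) : 0 < R := hK.r_pos.trans hK.r_lt_R

theorem eq_zero_of_lt (hK : IsRegressionKernel K LK Klow r R) {x : ℝ} (hx : R < x) : K x = 0 := by
  have h0 := hK.R_pos.trans hx
  refine le_antisymm ?_ (hK.nonneg x h0.le)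
  have h := hK.upper x h0
  rwa [indicator_of_notMem] at h
  rw [mem_closedBall_zero_iff, Real.norm_of_nonneg h0.le]
  exact not_le.2 hx

theorem abs_sub_le (hK : IsRegressionKernel K LK Klow r R) {x y : ℝ} (hx : 0 ≤ x) (hy : 0 ≤ y) :
    |K x - K y| ≤ LK * |x - y| := by
  simpa [Real.dist_eq] using hK.lipschitz.dist_le_mul x hx y hy

theorem measurable_comp_max (hK : IsRegressionKernel K LK Klow r R) :
    Measurable fun x => K (max x 0) :=
  (hK.lipschitz.continuousOn.comp_continuous (continuous_id.max continuous_const)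
    fun _ => mem_Ici.2 (le_max_right _ _)).measurable

theorem measurable_comp (hK : IsRegressionKernel K LK Klow r R) {α : Type*} [MeasurableSpace α]
    {g : α → ℝ} (hg : Measurable g) (h0 : ∀ a, 0 ≤ g a) : Measurable fun a => K (g a) := by
  have h := hK.measurable_comp_max.comp hg
  refine (congrArg Measurable ?_).mp h
  funext a
  simp [max_eq_left (h0 a)]

end IsRegressionKernel

end RegressionKernel

section Deterministic

variable {K : ℝ → ℝ} {LK : ℝ≥0} {Klow r R : ℝ} {m : ℕ} {h q M : ℝ} {D D' δ y φ ν : Fin m → ℝ}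
  {δ₀ φ₀ : ℝ}

theorem abs_weighted_mean_sub_le {w : Fin m → ℝ} (hw : ∀ i, 0 ≤ w i) (hM : 0 ≤ M)
    (hy : ∀ i, |y i| ≤ M) (hφ₀ : |φ₀| ≤ M) :
    |(if 0 < ∑ i, w i then (∑ i, y i * w i) / ∑ i, w i else 0) - φ₀| ≤ 2 * M := by
  have h1 : |if 0 < ∑ i, w i then (∑ i, y i * w i) / ∑ i, w i else 0| ≤ M := by
    split_ifs with hS
    · rw [abs_div, abs_of_pos hS, div_le_iff₀ hS, Finset.mul_sum]
      refine (Finset.abs_sum_le_sum_abs _ _).trans (Finset.sum_le_sum fun i _ => ?_)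
      rw [abs_mul, abs_of_nonneg (hw i)]
      exact mul_le_mul_of_nonneg_right (hy i) (hw i)
    · rwa [abs_zero]
  calc _ ≤ _ + |φ₀| := _root_.abs_sub _ _
    _ ≤ 2 * M := by linarith

theorem one_le_of_sum_kernel_lt (hK : IsRegressionKernel K LK Klow r R) (hm : 1 ≤ m) (hh : 0 < h)
    (hq : 0 < q) (hD' : ∀ i, 0 ≤ D' i) (hδ : ∀ i, 0 ≤ δ i)
    (hδ₀ : 0 ≤ δ₀) (hDD : ∀ i, |D' i - D i| ≤ δ i + δ₀) (hS : ∑ i, K (D' i / h) < Klow * m * q / 4) :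
    1 ≤ 4 * δ₀ / (r * h) + 16 / (q * r * h) * ((∑ i, δ i) / m) +
      2 * |1 / (m * q) * ∑ i, ((if D i ≤ r * h / 2 then 1 else 0) - q)| := by
  by_contra! hlt
  have hm0 : (0 : ℝ) < m := by exact_mod_cast hm
  have hr := hK.r_pos
  have hKl := hK.Klow_pos
  have hrh : 0 < r * h := mul_pos hr hh
  have hδs : 0 ≤ ∑ i, δ i := Finset.sum_nonneg fun i _ => hδ i
  have t1 : 0 ≤ 4 * δ₀ / (r * h) := by positivity
  have t2 : 0 ≤ 16 / (q * r * h) * ((∑ i, δ i) / m) := by positivity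
  have t3 := abs_nonneg (1 / (m * q) * ∑ i, ((if D i ≤ r * h / 2 then 1 else 0) - q))
  have hpt : ∀ i, Klow * ((if D i ≤ r * h / 2 then 1 else 0) - 4 * δ i / (r * h))
      ≤ K (D' i / h) + Klow * max 0 (4 * δ₀ / (r * h) - 1) := fun i => by
    have hK0 := hK.nonneg (D' i / h) (div_nonneg (hD' i) hh.le)
    have hmax : 0 ≤ Klow * max 0 (4 * δ₀ / (r * h) - 1) := by positivity
    have hδi : 0 ≤ 4 * δ i / (r * h) := div_nonneg (by linarith [hδ i]) hrh.le
    split_ifs with h1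
    · by_cases h2 : 4 * δ i / (r * h) ≤ 1
      · by_cases h3 : 4 * δ₀ / (r * h) ≤ 1
        · rw [div_le_one hrh] at h2 h3
          have h4 := (abs_le.1 (hDD i)).2
          have h5 : D' i / h ≤ r := by
            rw [div_le_iff₀ hh]
            linarith
          have h6 := hK.le_of_le (div_nonneg (hD' i) hh.le) h5
          nlinarith
        · push Not at h3
          exfalso
          linarith
      · push Not at h2
        nlinarith
    · nlinarith
  have h0 : max 0 (4 * δ₀ / (r * h) - 1) = 0 := max_eq_left (by linarith)
  have hsum := Finset.sum_le_sum fun i (_ : i ∈ Finset.univ) => hpt i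
  rw [h0] at hsum
  simp only [mul_zero, add_zero] at hsum
  rw [← Finset.mul_sum, Finset.sum_sub_distrib, ← Finset.sum_div, ← Finset.mul_sum] at hsum
  rw [abs_mul, abs_of_pos (by positivity : 0 < 1 / (m * q)), Finset.sum_sub_distrib] at hlt t3
  simp only [Finset.sum_const, Finset.card_univ, Fintype.card_fin, nsmul_eq_mul] at hlt t3
  set A : ℝ := ∑ i, if D i ≤ r * h / 2 then (1 : ℝ) else 0
  have hmq : 0 < m * q := by positivity
  have h1 : 4 * (∑ i, δ i) / (r * h) < m * q / 4 := by
    have h2 : 16 / (q * r * h) * ((∑ i, δ i) / m) =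
        4 * (4 * (∑ i, δ i) / (r * h)) / (m * q) := by
      field_simp
      ring
    have h3 : 4 * (4 * (∑ i, δ i) / (r * h)) / (m * q) < 1 := by linarith
    rw [div_lt_one hmq] at h3
    linarith
  have h2 : |A - m * q| < m * q / 2 := by
    have h3 : 1 / (m * q) * |A - m * q| < 1 / 2 := by linarith
    rw [one_div_mul_eq_div, div_lt_iff₀ hmq] at h3
    linarith
  have h3 := (abs_lt.1 h2).1
  have h4 : Klow * (m * q / 4) < Klow * (A - 4 * (∑ i, δ i) / (r * h)) :=
    mul_lt_mul_of_pos_left (by linarith) hKl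
  linarith

theorem abs_kernel_mean_sub_le (hK : IsRegressionKernel K LK Klow r R) (hm : 1 ≤ m) (hh : 0 < h)
    (hq : 0 < q) (hM : 0 ≤ M) {L β : ℝ} (hL : 0 ≤ L) (hβ : 0 ≤ β) (hD : ∀ i, 0 ≤ D i)
    (hD' : ∀ i, 0 ≤ D' i) (hδ : ∀ i, 0 ≤ δ i) (hδ₀ : 0 ≤ δ₀)
    (hDD : ∀ i, |D' i - D i| ≤ δ i + δ₀) (hy : ∀ i, y i = φ i + ν i) (hyM : ∀ i, |y i| ≤ M)
    (hφM : ∀ i, |φ i| ≤ M) (hφ₀ : |φ₀| ≤ M) (hφ : ∀ i, |φ i - φ₀| ≤ L * D i ^ β) :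
    |(if 0 < ∑ i, K (D' i / h) then (∑ i, y i * K (D' i / h)) / ∑ i, K (D' i / h) else 0) - φ₀| ≤
      2 * M * (4 * δ₀ / (r * h) + 16 / (q * r * h) * ((∑ i, δ i) / m) +
        2 * |1 / (m * q) * ∑ i, ((if D i ≤ r * h / 2 then 1 else 0) - q)|) +
      4 / Klow * |1 / (m * q) * ∑ i, K (D i / h) * ν i| +
      8 * M * LK / (Klow * h * q) * ((∑ i, δ i) / m + δ₀) +
      2 * M / (R * h) * (δ₀ + 4 / (Klow * q) * ((∑ i, δ i) / m)) + L * (2 * R * h) ^ β := by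
  have hm0 : (0 : ℝ) < m := by exact_mod_cast hm
  have hr := hK.r_pos
  have hR := hK.R_pos
  have hKl := hK.Klow_pos
  have hδs : 0 ≤ ∑ i, δ i := Finset.sum_nonneg fun i _ => hδ i
  have hw0 : ∀ i, 0 ≤ K (D' i / h) := fun i => hK.nonneg _ (div_nonneg (hD' i) hh.le)
  have t2 : 0 ≤ 4 / Klow * |1 / (m * q) * ∑ i, K (D i / h) * ν i| := by positivity
  have t3 : 0 ≤ 8 * M * LK / (Klow * h * q) * ((∑ i, δ i) / m + δ₀) := by positivity
  have t4 : 0 ≤ 2 * M / (R * h) * (δ₀ + 4 / (Klow * q) * ((∑ i, δ i) / m)) := by positivity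
  have t5 : 0 ≤ L * (2 * R * h) ^ β := by positivity
  by_cases hS : ∑ i, K (D' i / h) < Klow * m * q / 4
  · have h1 := one_le_of_sum_kernel_lt hK hm hh hq hD' hδ hδ₀ hDD hS
    have h2 := abs_weighted_mean_sub_le hw0 hM hyM hφ₀
    have h3 := mul_le_mul_of_nonneg_left h1 (by positivity : 0 ≤ 2 * M)
    linarith
  have t1 : 0 ≤ 2 * M * (4 * δ₀ / (r * h) + 16 / (q * r * h) * ((∑ i, δ i) / m) +
        2 * |1 / (m * q) * ∑ i, ((if D i ≤ r * h / 2 then 1 else 0) - q)|) := by positivity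
  push Not at hS
  have hT : 0 < Klow * m * q / 4 := by positivity
  set S := ∑ i, K (D' i / h) with hSdef
  have hS0 : 0 < S := hT.trans_le hS
  rw [if_pos hS0]
  have hsplit : (∑ i, y i * K (D' i / h)) / S - φ₀ =
      (∑ i, K (D i / h) * ν i + ∑ i, ν i * (K (D' i / h) - K (D i / h)) +
        ∑ i, (φ i - φ₀) * K (D' i / h)) / S := by
    rw [eq_div_iff hS0.ne', sub_mul, div_mul_cancel₀ _ hS0.ne', hSdef, Finset.mul_sum,
      ← Finset.sum_sub_distrib, ← Finset.sum_add_distrib, ← Finset.sum_add_distrib]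
    refine Finset.sum_congr rfl fun i _ => ?_
    rw [hy i]
    ring
  have hνM : ∀ i, |ν i| ≤ 2 * M := fun i => by
    have h1 : ν i = y i - φ i := by rw [hy i]; ring
    rw [h1]
    have := _root_.abs_sub (y i) (φ i)
    linarith [hyM i, hφM i]
  have h2 : |∑ i, ν i * (K (D' i / h) - K (D i / h))| ≤
      2 * M * LK / h * (∑ i, δ i + m * δ₀) := by
    have h3 : ∑ i, δ i + m * δ₀ = ∑ i, (δ i + δ₀) := by
      rw [Finset.sum_add_distrib]
      simp
    rw [h3, Finset.mul_sum]
    refine (Finset.abs_sum_le_sum_abs _ _).trans (Finset.sum_le_sum fun i _ => ?_)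
    rw [abs_mul]
    have h4 : |K (D' i / h) - K (D i / h)| ≤ LK * ((δ i + δ₀) / h) := by
      refine (hK.abs_sub_le (div_nonneg (hD' i) hh.le) (div_nonneg (hD i) hh.le)).trans ?_
      rw [← sub_div, abs_div, abs_of_pos hh]
      gcongr
      exact hDD i
    calc |ν i| * |K (D' i / h) - K (D i / h)| ≤ 2 * M * (LK * ((δ i + δ₀) / h)) :=
          mul_le_mul (hνM i) h4 (abs_nonneg _) (by positivity)
      _ = _ := by ring
  have h3 : |∑ i, (φ i - φ₀) * K (D' i / h)| ≤
      (L * (2 * R * h) ^ β + 2 * M / (R * h) * δ₀) * S + 2 * M / (R * h) * ∑ i, δ i := by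
    rw [hSdef, Finset.mul_sum, Finset.mul_sum, ← Finset.sum_add_distrib]
    refine (Finset.abs_sum_le_sum_abs _ _).trans (Finset.sum_le_sum fun i _ => ?_)
    rw [abs_mul, abs_of_nonneg (hw0 i)]
    have hδi := hδ i
    have hRd : 0 ≤ 2 * M / (R * h) * δ i := by positivity
    by_cases hi : R < D' i / h
    · rw [hK.eq_zero_of_lt hi, mul_zero, mul_zero, zero_add]
      exact hRd
    push Not at hi
    rw [div_le_iff₀ hh] at hi
    have hw1 := hK.le_one (div_nonneg (hD' i) hh.le)
    have h4 : |φ i - φ₀| ≤ L * (2 * R * h) ^ β + 2 * M / (R * h) * (δ i + δ₀) := by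
      by_cases h5 : δ i + δ₀ ≤ R * h
      · have h6 : D i ≤ 2 * R * h := by
          have := (abs_le.1 (hDD i)).1
          linarith
        have h7 : L * D i ^ β ≤ L * (2 * R * h) ^ β := by
          gcongr
          exact hD i
        have h8 : 0 ≤ 2 * M / (R * h) * (δ i + δ₀) := by positivity
        linarith [hφ i]
      · push Not at h5
        have h6 : 2 * M ≤ 2 * M / (R * h) * (δ i + δ₀) := by
          rw [div_mul_eq_mul_div, le_div_iff₀ (by positivity)]
          gcongr
        have h7 := _root_.abs_sub (φ i) φ₀
        linarith [hφM i]
    calc |φ i - φ₀| * K (D' i / h)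
        ≤ (L * (2 * R * h) ^ β + 2 * M / (R * h) * (δ i + δ₀)) * K (D' i / h) := by
          gcongr
          exact hw0 i
      _ = (L * (2 * R * h) ^ β + 2 * M / (R * h) * δ₀) * K (D' i / h) +
          2 * M / (R * h) * δ i * K (D' i / h) := by ring
      _ ≤ _ := by
          have h9 := mul_le_of_le_one_right hRd hw1
          linarith
  rw [hsplit, abs_div, abs_of_pos hS0]
  have h4 : |∑ i, K (D i / h) * ν i + ∑ i, ν i * (K (D' i / h) - K (D i / h)) +
        ∑ i, (φ i - φ₀) * K (D' i / h)| / S ≤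
      (|∑ i, K (D i / h) * ν i| + 2 * M * LK / h * (∑ i, δ i + m * δ₀) +
        2 * M / (R * h) * ∑ i, δ i) / (Klow * m * q / 4) +
        (L * (2 * R * h) ^ β + 2 * M / (R * h) * δ₀) := by
    calc _ ≤ ((|∑ i, K (D i / h) * ν i| + 2 * M * LK / h * (∑ i, δ i + m * δ₀) +
        2 * M / (R * h) * ∑ i, δ i) + (L * (2 * R * h) ^ β + 2 * M / (R * h) * δ₀) * S) / S := by
          gcongr
          have := abs_add_three (∑ i, K (D i / h) * ν i)
            (∑ i, ν i * (K (D' i / h) - K (D i / h))) (∑ i, (φ i - φ₀) * K (D' i / h))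
          linarith
      _ = (|∑ i, K (D i / h) * ν i| + 2 * M * LK / h * (∑ i, δ i + m * δ₀) +
        2 * M / (R * h) * ∑ i, δ i) / S + (L * (2 * R * h) ^ β + 2 * M / (R * h) * δ₀) := by
          rw [add_div, mul_div_cancel_right₀ _ hS0.ne']
      _ ≤ _ := by gcongr
  refine h4.trans ?_
  have h5 : (|∑ i, K (D i / h) * ν i| + 2 * M * LK / h * (∑ i, δ i + m * δ₀) +
        2 * M / (R * h) * ∑ i, δ i) / (Klow * m * q / 4) =
      4 / Klow * |1 / (m * q) * ∑ i, K (D i / h) * ν i| +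
      8 * M * LK / (Klow * h * q) * ((∑ i, δ i) / m + δ₀) +
      2 * M / (R * h) * (4 / (Klow * q) * ((∑ i, δ i) / m)) := by
    rw [abs_mul, abs_of_pos (by positivity : 0 < 1 / (m * q))]
    field_simp
    ring
  rw [h5]
  linarith

end Deterministic

section Functional

variable {k : ℕ} {𝒦 : Set (E k)} {f : Distr 𝒦 → ℝ} {L β : ℝ}

theorem continuous_of_holder (hβ : 0 < β) (hf : ∀ P Q, |f P - f Q| ≤ L * dist P Q ^ β) :
    Continuous f := by
  refine continuous_iff_continuousAt.2 fun Q => ?_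
  rw [ContinuousAt, tendsto_iff_dist_tendsto_zero]
  refine squeeze_zero (fun P => dist_nonneg) (fun P => hf P Q) ?_
  have h1 : Continuous fun P : Distr 𝒦 => L * dist P Q ^ β :=
    continuous_const.mul ((continuous_id.dist continuous_const).rpow_const fun _ => Or.inr hβ.le)
  have h2 := h1.tendsto Q
  rwa [dist_self, Real.zero_rpow hβ.ne', mul_zero] at h2

end Functional

section Bandwidth

theorem bandwidth_eq (k n : ℕ) :
    (n : ℝ) ^ (-1 / ((k : ℝ) + 2)) = 1 / (n : ℝ) ^ (1 / ((k : ℝ) + 2)) := by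
  rw [neg_div, Real.rpow_neg (Nat.cast_nonneg n), one_div ((n : ℝ) ^ _)]

theorem bandwidth_pos (k : ℕ) {n : ℕ} (hn : 1 ≤ n) : 0 < (n : ℝ) ^ (-1 / ((k : ℝ) + 2)) :=
  Real.rpow_pos_of_pos (by exact_mod_cast hn) _

theorem bandwidth_le_one (k : ℕ) {n : ℕ} (hn : 1 ≤ n) : (n : ℝ) ^ (-1 / ((k : ℝ) + 2)) ≤ 1 :=
  Real.rpow_le_one_of_one_le_of_nonpos (by exact_mod_cast hn)
    (div_nonpos_of_nonpos_of_nonneg (by norm_num) (by positivity))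

theorem one_div_mul_bandwidth_pow_le (k : ℕ) {n N : ℕ} (hn : 1 ≤ n) (hN : n ≤ N) :
    1 / (N * ((n : ℝ) ^ (-1 / ((k : ℝ) + 2))) ^ k) ≤ ((n : ℝ) ^ (-1 / ((k : ℝ) + 2))) ^ 2 := by
  have hn0 : (0 : ℝ) < n := by exact_mod_cast hn
  have hb := bandwidth_pos k hn
  have h1 : ((n : ℝ) ^ (-1 / ((k : ℝ) + 2))) ^ 2 * (n * ((n : ℝ) ^ (-1 / ((k : ℝ) + 2))) ^ k)
      = 1 := by
    rw [mul_left_comm, ← pow_add, ← Real.rpow_natCast, ← Real.rpow_mul hn0.le]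
    push_cast
    rw [show -1 / ((k : ℝ) + 2) * (2 + k) = -1 by field_simp; ring, Real.rpow_neg_one,
      mul_inv_cancel₀ hn0.ne']
  have hN' : (n : ℝ) ≤ N := by exact_mod_cast hN
  have hN0 : (0 : ℝ) < N := hn0.trans_le hN'
  rw [div_le_iff₀ (by positivity)]
  refine h1.ge.trans ?_
  gcongr

end Bandwidth

namespace IsSample

variable {k m : ℕ} {𝒦 : Set (E k)} {Ω : Type u} [MeasurableSpace Ω] {Pr : Measure Ω}
  {π : Measure (Distr 𝒦)} {f : Distr 𝒦 → ℝ} {BY : ℝ} {N : Fin (m + 1) → ℕ}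
  {P : Fin (m + 1) → Ω → Distr 𝒦} {X : ∀ i : Fin (m + 1), Fin (N i) → Ω → E k}
  {Y μ : Fin (m + 1) → Ω → ℝ}

theorem isConditionalSample (hs : IsSample Pr π f BY N P X Y μ) (i : Fin (m + 1)) :
    IsConditionalSample Pr π (P i) (X i) :=
  ⟨hs.measurable_P i, hs.measurable_X i, hs.law_X i⟩

theorem noise_eq (hs : IsSample Pr π f BY N P X Y μ) (i : Fin (m + 1)) :
    μ i = fun ω => Y i ω - f (P i ω) := by
  funext ω
  rw [hs.model i ω]
  ring

theorem measurable_noise (hs : IsSample Pr π f BY N P X Y μ) (hf : Measurable f)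
    (i : Fin (m + 1)) : Measurable (μ i) := by
  rw [hs.noise_eq i]
  exact (hs.measurable_Y i).sub (hf.comp (hs.measurable_P i))

theorem iIndepFun_noise (hs : IsSample Pr π f BY N P X Y μ) (hf : Measurable f) :
    iIndepFun (fun i ω => (P i ω, μ i ω)) Pr := by
  have h := hs.indep.comp
    (fun i (z : Distr 𝒦 × (Fin (N i) → E k) × ℝ) => (z.1, z.2.2 - f z.1))
    fun i => measurable_fst.prodMk
      ((measurable_snd.comp measurable_snd).sub (hf.comp measurable_fst))
  refine (congrArg (fun Z => iIndepFun Z Pr) ?_).mp h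
  funext i ω
  simp [hs.noise_eq i]

theorem ae_law (hs : IsSample Pr π f BY N P X Y μ) {p : Distr 𝒦 → Prop} (h : ∀ᵐ s ∂π, p s)
    (i : Fin (m + 1)) : ∀ᵐ ω ∂Pr, p (P i ω) := by
  rw [← hs.law_P i] at h
  exact ae_of_ae_map (hs.measurable_P i).aemeasurable h

theorem measReal_dist_le (hs : IsSample Pr π f BY N P X Y μ) (i : Fin (m + 1)) (s : Distr 𝒦)
    (ρ : ℝ) : Pr.real {ω | dist (P i ω) s ≤ ρ} = π.real (Metric.closedBall s ρ) := by
  rw [← hs.law_P i, map_measureReal_apply (hs.measurable_P i) Metric.isClosed_closedBall.measurableSet]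
  rfl

theorem measurableSet_dist_le (hs : IsSample Pr π f BY N P X Y μ) (i : Fin (m + 1)) (s : Distr 𝒦)
    (ρ : ℝ) : MeasurableSet {ω | dist (P i ω) s ≤ ρ} :=
  measurableSet_le ((hs.measurable_P i).dist measurable_const) measurable_const

theorem integral_dist_le (hs : IsSample Pr π f BY N P X Y μ) (i : Fin (m + 1)) (s : Distr 𝒦)
    (ρ : ℝ) :
    ∫ ω, (if dist (P i ω) s ≤ ρ then (1 : ℝ) else 0) ∂Pr = π.real (Metric.closedBall s ρ) := by
  rw [← hs.measReal_dist_le i, ← integral_indicator_one (hs.measurableSet_dist_le i s ρ)]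
  rfl

theorem integrable_dist_le (hs : IsSample Pr π f BY N P X Y μ) (i : Fin (m + 1)) (s : Distr 𝒦)
    (ρ : ℝ) : Integrable (fun ω => if dist (P i ω) s ≤ ρ then (1 : ℝ) else 0) Pr := by
  have := hs.isProbabilityMeasure
  exact (integrable_const (1 : ℝ)).indicator (hs.measurableSet_dist_le i s ρ)

/-- Fluctuation of the fraction of covariates in a ball around the new one. -/
theorem integral_abs_sum_dist_le_sub [IsProbabilityMeasure π]
    (hs : IsSample Pr π f BY N P X Y μ) (hf : Measurable f) (hm : 1 ≤ m) {ρ Q : ℝ}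
    (hQ : 0 < Q) (hπ : ∀ᵐ s ∂π, 0 < π.real (Metric.closedBall s ρ) ∧
      1 / π.real (Metric.closedBall s ρ) ≤ Q) :
    Integrable (fun ω => |1 / (m * π.real (Metric.closedBall (P (Fin.last m) ω) ρ)) *
      ∑ i : Fin m, ((if dist (P i.castSucc ω) (P (Fin.last m) ω) ≤ ρ then 1 else 0) -
        π.real (Metric.closedBall (P (Fin.last m) ω) ρ))|) Pr ∧
    ∫ ω, |1 / (m * π.real (Metric.closedBall (P (Fin.last m) ω) ρ)) *
      ∑ i : Fin m, ((if dist (P i.castSucc ω) (P (Fin.last m) ω) ≤ ρ then 1 else 0) -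
        π.real (Metric.closedBall (P (Fin.last m) ω) ρ))| ∂Pr ≤ √(Q / m) := by
  have := hs.isProbabilityMeasure
  have hm0 : (0 : ℝ) < m := by exact_mod_cast hm
  have hq := measurable_measReal_closedBall (π := π) ρ
  have hgm : Measurable fun z : Distr 𝒦 × Distr 𝒦 × ℝ =>
      (if dist z.2.1 z.1 ≤ ρ then (1 : ℝ) else 0) - π.real (Metric.closedBall z.1 ρ) := by
    refine Measurable.sub (Measurable.ite (measurableSet_le ?_ measurable_const) measurable_const
      measurable_const) (hq.comp measurable_fst)
    exact (measurable_fst.comp measurable_snd).dist measurable_fst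
  have hwm : Measurable fun s : Distr 𝒦 => 1 / (m * π.real (Metric.closedBall s ρ)) :=
    measurable_const.div (hq.const_mul _)
  have hZ : ∀ i, Measurable fun ω => (P i ω, μ i ω) := fun i =>
    (hs.measurable_P i).prodMk (hs.measurable_noise hf i)
  have hlaw : Pr.map (fun ω => (P (Fin.last m) ω, μ (Fin.last m) ω).1) = π :=
    hs.law_P (Fin.last m)
  refine integral_abs_le_sqrt ?_ (by positivity) ?_
  · refine (hwm.comp (hs.measurable_P (Fin.last m))).mul
      (Finset.measurable_fun_sum _ fun i _ => ?_)
    have hpair : Measurable fun ω => (P (Fin.last m) ω, (P i.castSucc ω, μ i.castSucc ω)) :=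
      (hs.measurable_P (Fin.last m)).prodMk (hZ i.castSucc)
    have hcomp := Measurable.comp hgm hpair
    simp only [Function.comp_def] at hcomp
    exact hcomp
  have h := lintegral_sq_weighted_sum_le (V := Q / m ^ 2) (Z := fun i ω => (P i ω, μ i ω))
    (p := Prod.fst)
    (g := fun s z => (if dist z.1 s ≤ ρ then (1 : ℝ) else 0) - π.real (Metric.closedBall s ρ))
    (w := fun s => 1 / (m * π.real (Metric.closedBall s ρ))) hZ (hs.iIndepFun_noise hf)
    measurable_fst hlaw hgm hwm ?_
  · refine h.trans_eq ?_
    congr 1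
    field_simp
  filter_upwards [hπ] with s hqs i
  obtain ⟨hq0, hqQ⟩ := hqs
  have hI := hs.integrable_dist_le i.castSucc s ρ
  have hIe := hs.integral_dist_le i.castSucc s ρ
  set q := π.real (Metric.closedBall s ρ)
  have hq1 : q ≤ 1 := measureReal_le_one
  refine ⟨?_, ?_, ?_⟩
  · refine MemLp.of_bound (hgm.comp (measurable_prodMk_left.comp (hZ i.castSucc))).aestronglyMeasurable
      1 (ae_of_all _ fun ω => ?_)
    simp only [Real.norm_eq_abs]
    split_ifs <;> rw [abs_le] <;> constructor <;> linarith
  · rw [integral_sub hI (integrable_const _), hIe]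
    simp
  · have h1 : ∀ ω, ((if dist (P i.castSucc ω) s ≤ ρ then (1 : ℝ) else 0) - q) ^ 2 =
        (1 - 2 * q) * (if dist (P i.castSucc ω) s ≤ ρ then (1 : ℝ) else 0) + q ^ 2 := fun ω => by
      split_ifs <;> ring
    simp_rw [h1]
    rw [integral_add (hI.const_mul _) (integrable_const _), integral_const_mul, hIe]
    simp only [integral_const, probReal_univ, one_smul]
    calc (1 / (m * q)) ^ 2 * ((1 - 2 * q) * q + q ^ 2) ≤ (1 / (m * q)) ^ 2 * q := by
          gcongr
          nlinarith
      _ = 1 / q / m ^ 2 := by field_simp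
      _ ≤ Q / m ^ 2 := by gcongr

/-- Fluctuation of the kernel average of the noise. -/
theorem integral_abs_sum_kernel_mul_noise_le [IsProbabilityMeasure π] {K : ℝ → ℝ} {LK : ℝ≥0}
    {Klow r R h ρ Q M C : ℝ} (hK : IsRegressionKernel K LK Klow r R)
    (hs : IsSample Pr π f BY N P X Y μ) (hf : Measurable f) (hm : 1 ≤ m) (hh : 0 < h)
    (hQ : 0 < Q) (hM : 0 < M) (hC : 0 < C) (hμ : ∀ i, ∀ᵐ ω ∂Pr, |μ i ω| ≤ M)
    (hπ : ∀ᵐ s ∂π, 0 < π.real (Metric.closedBall s ρ) ∧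
      1 / π.real (Metric.closedBall s ρ) ≤ Q ∧
      π.real (Metric.closedBall s (R * h)) ≤ C * π.real (Metric.closedBall s ρ)) :
    Integrable (fun ω => |1 / (m * π.real (Metric.closedBall (P (Fin.last m) ω) ρ)) *
      ∑ i : Fin m, K (dist (P i.castSucc ω) (P (Fin.last m) ω) / h) * μ i.castSucc ω|) Pr ∧
    ∫ ω, |1 / (m * π.real (Metric.closedBall (P (Fin.last m) ω) ρ)) *
      ∑ i : Fin m, K (dist (P i.castSucc ω) (P (Fin.last m) ω) / h) * μ i.castSucc ω| ∂Pr ≤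
        √(M ^ 2 * C * Q / m) := by
  have := hs.isProbabilityMeasure
  have hm0 : (0 : ℝ) < m := by exact_mod_cast hm
  have hq := measurable_measReal_closedBall (π := π) ρ
  have hKm : Measurable fun z : Distr 𝒦 × Distr 𝒦 => K (dist z.1 z.2 / h) :=
    hK.measurable_comp ((measurable_fst.dist measurable_snd).div_const h)
      fun z => div_nonneg dist_nonneg hh.le
  have hgm : Measurable fun z : Distr 𝒦 × Distr 𝒦 × ℝ =>
      K (dist z.2.1 z.1 / h) * z.2.2 :=
    (hKm.comp ((measurable_fst.comp measurable_snd).prodMk measurable_fst)).mul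
      (measurable_snd.comp measurable_snd)
  have hwm : Measurable fun s : Distr 𝒦 => 1 / (m * π.real (Metric.closedBall s ρ)) :=
    measurable_const.div (hq.const_mul _)
  have hZ : ∀ i, Measurable fun ω => (P i ω, μ i ω) := fun i =>
    (hs.measurable_P i).prodMk (hs.measurable_noise hf i)
  have hK0 : ∀ p s : Distr 𝒦, 0 ≤ K (dist p s / h) := fun p s =>
    hK.nonneg _ (div_nonneg dist_nonneg hh.le)
  have hK1 : ∀ p s : Distr 𝒦, K (dist p s / h) ≤ 1 := fun p s =>
    hK.le_one (div_nonneg dist_nonneg hh.le)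
  have hlaw : Pr.map (fun ω => (P (Fin.last m) ω, μ (Fin.last m) ω).1) = π :=
    hs.law_P (Fin.last m)
  refine integral_abs_le_sqrt ?_ (by positivity) ?_
  · refine (hwm.comp (hs.measurable_P (Fin.last m))).mul
      (Finset.measurable_fun_sum _ fun i _ => ?_)
    have hpair : Measurable fun ω => (P (Fin.last m) ω, (P i.castSucc ω, μ i.castSucc ω)) :=
      (hs.measurable_P (Fin.last m)).prodMk (hZ i.castSucc)
    have hcomp := Measurable.comp hgm hpair
    simp only [Function.comp_def] at hcomp
    exact hcomp
  have h := lintegral_sq_weighted_sum_le (V := M ^ 2 * C * Q / m ^ 2)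
    (Z := fun i ω => (P i ω, μ i ω)) (p := Prod.fst) (g := fun s z => K (dist z.1 s / h) * z.2)
    (w := fun s => 1 / (m * π.real (Metric.closedBall s ρ))) hZ (hs.iIndepFun_noise hf)
    measurable_fst hlaw hgm hwm ?_
  · refine h.trans_eq ?_
    congr 1
    field_simp
  filter_upwards [hπ] with s hqs i
  obtain ⟨hq0, hqQ, hqC⟩ := hqs
  have hI := hs.integrable_dist_le i.castSucc s (R * h)
  have hIe := hs.integral_dist_le i.castSucc s (R * h)
  set q := π.real (Metric.closedBall s ρ)
  have hg2 : MemLp (fun ω => K (dist (P i.castSucc ω) s / h) * μ i.castSucc ω) 2 Pr := by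
    refine MemLp.of_bound
      (hgm.comp (measurable_prodMk_left.comp (hZ i.castSucc))).aestronglyMeasurable (1 * M) ?_
    filter_upwards [hμ i.castSucc] with ω hω
    rw [norm_mul, Real.norm_of_nonneg (hK0 _ _)]
    exact mul_le_mul (hK1 _ _) hω (norm_nonneg _) zero_le_one
  refine ⟨hg2, ?_, ?_⟩
  · refine integral_mul_comp_eq_zero (hs.measurable_P i.castSucc) (hs.integrable_noise _)
      (hs.centred_noise _) (φ := fun p => K (dist p s / h))
      (hKm.comp (measurable_id.prodMk measurable_const)) (C := 1) fun p => ?_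
    rw [abs_of_nonneg (hK0 _ _)]
    exact hK1 _ _
  · have hle : ∫ ω, (K (dist (P i.castSucc ω) s / h) * μ i.castSucc ω) ^ 2 ∂Pr ≤
        M ^ 2 * (C * q) := by
      refine (integral_mono_ae hg2.integrable_sq (hI.const_mul (M ^ 2)) ?_).trans ?_
      · filter_upwards [hμ i.castSucc] with ω hω
        split_ifs with hd
        · rw [mul_one, ← sq_abs, abs_mul, abs_of_nonneg (hK0 _ _)]
          have h1 := mul_le_mul (hK1 (P i.castSucc ω) s) hω (abs_nonneg _) zero_le_one
          rw [one_mul] at h1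
          exact pow_le_pow_left₀ (mul_nonneg (hK0 _ _) (abs_nonneg _)) h1 2
        · rw [hK.eq_zero_of_lt ((lt_div_iff₀ hh).2 (not_le.1 hd))]
          simp
      · rw [integral_const_mul, hIe]
        gcongr
    calc (1 / (m * q)) ^ 2 * ∫ ω, (K (dist (P i.castSucc ω) s / h) * μ i.castSucc ω) ^ 2 ∂Pr
        ≤ (1 / (m * q)) ^ 2 * (M ^ 2 * (C * q)) := by gcongr
      _ = M ^ 2 * C * (1 / q) / m ^ 2 := by field_simp
      _ ≤ M ^ 2 * C * Q / m ^ 2 := by gcongr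

end IsSample

section Doubling

variable {k : ℕ} {𝒦 : Set (E k)} {π : Measure (Distr 𝒦)} {c d : ℝ}

/-- The constant `c₀` in the small-ball bound `c₀ h ^ d ≤ π (closedBall s (r h / 2))`, `h ≤ 1`. -/
noncomputable def smallBallConst (c d r : ℝ) : ℝ := min 1 ((min r 1 / (4 * c)) ^ d)

theorem smallBallConst_pos (hc : 0 < c) {r : ℝ} (hr : 0 < r) : 0 < smallBallConst c d r := by
  unfold smallBallConst
  positivity

theorem smallBallConst_le_one (c d r : ℝ) : smallBallConst c d r ≤ 1 := min_le_left _ _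

theorem IsDoubling.smallBall [IsProbabilityMeasure π] (hπ : IsDoubling π c d) (hc : 0 < c)
    {r R h : ℝ} (hr : 0 < r) (hrR : r < R) (hh : 0 < h) (hh1 : h ≤ 1) :
    ∀ᵐ s ∂π, 0 < π.real (Metric.closedBall s (r * h / 2)) ∧
      1 / π.real (Metric.closedBall s (r * h / 2)) ≤ 1 / (smallBallConst c d r * h ^ d) ∧
      π.real (Metric.closedBall s (R * h)) ≤
        (c / (r / (2 * R))) ^ d * π.real (Metric.closedBall s (r * h / 2)) := by
  have hR : 0 < R := hr.trans hrR
  have hc0 := smallBallConst_pos (d := d) hc hr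
  filter_upwards [hπ.rpow_le_measReal_closedBall hc, hπ.measReal_closedBall_pos hc,
    hπ.measReal_closedBall_le hc] with s h1 h2 h3
  refine ⟨h2 _ (by positivity), ?_, ?_⟩
  · refine one_div_le_one_div_of_le (by positivity) ?_
    have h4 : min r 1 * h / 2 < 2 := by
      have : min r 1 * h ≤ 1 * 1 := mul_le_mul (min_le_right _ _) hh1 hh.le zero_le_one
      linarith
    calc smallBallConst c d r * h ^ d ≤ (min r 1 / (4 * c)) ^ d * h ^ d := by
          gcongr
          exact min_le_right _ _
      _ = (min r 1 * h / 2 / (2 * c)) ^ d := by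
          rw [← Real.mul_rpow (by positivity) hh.le]
          congr 1
          field_simp
          norm_num
      _ ≤ π.real (Metric.closedBall s (min r 1 * h / 2)) := h1 _ (by positivity) h4
      _ ≤ π.real (Metric.closedBall s (r * h / 2)) := by
          refine measureReal_mono (Metric.closedBall_subset_closedBall ?_)
          gcongr
          exact min_le_left _ _
  · have h4 := h3 (R * h) (by positivity) (r / (2 * R)) (by positivity)
      ((div_lt_one (by positivity)).2 (by linarith))
    rwa [show r / (2 * R) * (R * h) = r * h / 2 by field_simp] at h4

end Doubling

section Risk

variable {k m : ℕ} {𝒦 : Set (E k)} {Λ : ℝ≥0} {K B : ℝ → ℝ} {LK : ℝ≥0} {Klow r R L β fmax BY c d : ℝ}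
  {π : Measure (Distr 𝒦)} {f : Distr 𝒦 → ℝ} {n : ℕ} {N : Fin (m + 1) → ℕ} {Ω : Type u}
  [MeasurableSpace Ω] {Pr : Measure Ω} {P : Fin (m + 1) → Ω → Distr 𝒦}
  {X : ∀ i : Fin (m + 1), Fin (N i) → Ω → E k} {Y μ : Fin (m + 1) → Ω → ℝ} {h : ℝ}

theorem measurable_absError (hK : IsRegressionKernel K LK Klow r R) (hB : Measurable B)
    (hs : IsSample Pr π f BY N P X Y μ) (hf : Measurable f) (hh : 0 < h) :
    Measurable (absError K B h n f P X Y) := by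
  have hw : ∀ i : Fin m, Measurable fun ω =>
      K (l1Dist (kde B ((n : ℝ) ^ (-1 / ((k : ℝ) + 2))) fun j => X i.castSucc j ω)
        (kde B ((n : ℝ) ^ (-1 / ((k : ℝ) + 2))) fun j => X (Fin.last m) j ω) / h) := fun i =>
    hK.measurable_comp ((measurable_l1Dist (measurable_kde hB (hs.measurable_X i.castSucc))
      (measurable_kde hB (hs.measurable_X (Fin.last m)))).div_const h)
      fun ω => div_nonneg (l1Dist_nonneg _ _) hh.le
  have hS := Finset.measurable_fun_sum Finset.univ fun i _ => hw i
  have hYw := Finset.measurable_fun_sum Finset.univ fun i _ =>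
    (hs.measurable_Y (Fin.castSucc i)).mul (hw i)
  exact ((Measurable.ite (measurableSet_lt measurable_const hS) (hYw.div hS)
    measurable_const).sub (hf.comp (hs.measurable_P (Fin.last m)))).abs

theorem absError_ae_le (hK : IsRegressionKernel K LK Klow r R)
    (ha : IsAdmissible Λ L β fmax c d π f) (hs : IsSample Pr π f BY N P X Y μ) (hh : 0 < h) :
    ∀ᵐ ω ∂Pr, absError K B h n f P X Y ω ≤ 2 * (|BY| + |fmax| + 1) := by
  have hY : ∀ᵐ ω ∂Pr, ∀ i, |Y i ω| ≤ BY := ae_all_iff.2 hs.bounded_Y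
  filter_upwards [hY, hs.ae_law ha.bounded (Fin.last m)] with ω h1 h2
  refine abs_weighted_mean_sub_le
    (fun i => hK.nonneg _ (div_nonneg (l1Dist_nonneg _ _) hh.le)) (by positivity)
    (fun i => (h1 i.castSucc).trans ?_) (h2.trans ?_)
  · linarith [le_abs_self BY, abs_nonneg fmax]
  · linarith [abs_nonneg BY, le_abs_self fmax]

theorem integrable_absError (hK : IsRegressionKernel K LK Klow r R) (hB : Measurable B)
    (hβ : 0 < β) (ha : IsAdmissible Λ L β fmax c d π f) (hs : IsSample Pr π f BY N P X Y μ)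
    (hh : 0 < h) : Integrable (absError K B h n f P X Y) Pr := by
  have := hs.isProbabilityMeasure
  refine Integrable.of_bound (measurable_absError hK hB hs
    (continuous_of_holder hβ ha.holder).measurable hh).aestronglyMeasurable
    (2 * (|BY| + |fmax| + 1)) ?_
  filter_upwards [absError_ae_le (B := B) (n := n) hK ha hs hh] with ω hω
  have h0 : 0 ≤ absError K B h n f P X Y ω := abs_nonneg _
  rwa [Real.norm_of_nonneg h0]

theorem risk_le_const (hK : IsRegressionKernel K LK Klow r R) (hB : Measurable B)
    (hβ : 0 < β) (ha : IsAdmissible Λ L β fmax c d π f) (hs : IsSample Pr π f BY N P X Y μ)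
    (hh : 0 < h) : risk Pr K B h n f P X Y ≤ 2 * (|BY| + |fmax| + 1) := by
  have := hs.isProbabilityMeasure
  refine (integral_mono_ae (integrable_absError hK hB hβ ha hs hh)
    (integrable_const (2 * (|BY| + |fmax| + 1))) (absError_ae_le hK ha hs hh)).trans_eq ?_
  simp

/-- The constant in the bound `densityConst * b` for the expected `L¹` error of the density
estimator with bandwidth `b`. -/
noncomputable def densityConst {k : ℕ} (𝒦 : Set (E k)) (Λ : ℝ≥0) (B : ℝ → ℝ) (M ρ : ℝ) : ℝ :=
  (volume.real (Metric.cthickening ρ 𝒦) + M * ∫ x : E k, |B ‖x‖|) / 2 +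
    Λ * ρ * (∫ x : E k, |B ‖x‖|) * volume.real (Metric.cthickening ρ 𝒦)

theorem densityConst_nonneg {M ρ : ℝ} (hB : HasKernelBound B M ρ) :
    0 ≤ densityConst 𝒦 Λ B M ρ := by
  have h1 := hB.bound_nonneg
  have h2 := hB.radius_nonneg
  have h3 : 0 ≤ ∫ x : E k, |B ‖x‖| := integral_nonneg fun _ => abs_nonneg _
  unfold densityConst
  positivity

/-- The `L¹` errors of the density estimators dominate the error of the estimated distances. -/
theorem exists_density_error {M ρ : ℝ} (h𝒦 : IsCompact 𝒦) (hB : HasKernelBound B M ρ)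
    (hint : ∫ x : E k, B ‖x‖ = 1) (hn : 1 ≤ n) (hN : ∀ i, n ≤ N i)
    (ha : IsAdmissible Λ L β fmax c d π f) (hs : IsSample Pr π f BY N P X Y μ) :
    ∃ δ : Fin (m + 1) → Ω → ℝ, (∀ i ω, 0 ≤ δ i ω) ∧ (∀ i, Integrable (δ i) Pr) ∧
      (∀ i, ∫ ω, δ i ω ∂Pr ≤ densityConst 𝒦 Λ B M ρ * (n : ℝ) ^ (-1 / ((k : ℝ) + 2))) ∧
      ∀ᵐ ω ∂Pr, ∀ i j,
        |l1Dist (kde B ((n : ℝ) ^ (-1 / ((k : ℝ) + 2))) fun l => X i l ω)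
          (kde B ((n : ℝ) ^ (-1 / ((k : ℝ) + 2))) fun l => X j l ω) - dist (P i ω) (P j ω)|
          ≤ δ i ω + δ j ω := by
  have := hs.isProbabilityMeasure
  have := ha.isProbabilityMeasure
  have hb := bandwidth_pos k hn
  have hb1 := bandwidth_le_one k hn
  have hbN := fun i => one_div_mul_bandwidth_pow_le k hn (hN i)
  set b := (n : ℝ) ^ (-1 / ((k : ℝ) + 2))
  set V := volume.real (Metric.cthickening ρ 𝒦) with hV
  set I := ∫ x : E k, |B ‖x‖| with hI
  have h1 := hB.radius_nonneg
  have h3 : 0 ≤ I := integral_nonneg fun _ => abs_nonneg _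
  have hδ := fun i => integral_l1Dist_kde_smoothed_le h𝒦 (hs.isConditionalSample i) hB hb hb1
    (hn.trans (hN i)) (hbN i)
  refine ⟨fun i ω => l1Dist (kde B b fun j => X i j ω) (smoothed B b (P i ω)) +
    Λ * ρ * I * V * b, fun i ω => add_nonneg (l1Dist_nonneg _ _) (by positivity),
    fun i => (hδ i).1.add (integrable_const _), fun i => ?_, ?_⟩
  · rw [integral_add (hδ i).1 (integrable_const _)]
    simp only [integral_const, probReal_univ, one_smul]
    unfold densityConst
    linarith [(hδ i).2]
  · have hsm : ∀ᵐ ω ∂Pr, ∀ i, (P i ω).HasSmoothDensity Λ :=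
      ae_all_iff.2 fun i => hs.ae_law ha.smooth i
    filter_upwards [hsm] with ω hω i j
    have hkde := fun i => integrable_kde hB hb fun l => X i l ω
    have hpdf := fun i => (P i ω).integrable_pdf
    have hle : ∀ i, l1Dist (kde B b fun l => X i l ω) (P i ω).pdf ≤
        l1Dist (kde B b fun j => X i j ω) (smoothed B b (P i ω)) + Λ * ρ * I * V * b := fun i =>
      (l1Dist_triangle (hkde i) (integrable_smoothed h𝒦 hB hb hb1 _) (hpdf i)).trans
        (add_le_add_right (l1Dist_smoothed_pdf_le h𝒦 hB hb hb1 hint (hω i)) _)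
    rw [Distr.dist_eq, abs_le]
    have t1 := l1Dist_triangle (hkde i) (hpdf i) (hkde j)
    have t2 := l1Dist_triangle (hpdf i) (hpdf j) (hkde j)
    have t3 := l1Dist_triangle (hpdf i) (hkde i) (hpdf j)
    have t4 := l1Dist_triangle (hkde i) (hkde j) (hpdf j)
    rw [l1Dist_comm (P j ω).pdf] at t2
    rw [l1Dist_comm (P i ω).pdf (kde B b _)] at t3
    constructor <;> linarith [hle i, hle j]

theorem risk_le_of_le_one {M ρ : ℝ} (h𝒦 : IsCompact 𝒦) (hK : IsRegressionKernel K LK Klow r R)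
    (hB : HasKernelBound B M ρ) (hint : ∫ x : E k, B ‖x‖ = 1) (hL : 0 < L) (hβ : 0 < β)
    (hc : 0 < c) (hm : 1 ≤ m) (hn : 1 ≤ n) (hN : ∀ i, n ≤ N i)
    (ha : IsAdmissible Λ L β fmax c d π f) (hs : IsSample Pr π f BY N P X Y μ) (hh : 0 < h)
    (hh1 : h ≤ 1) {A Q Δ cc : ℝ} (hA : A = |BY| + |fmax| + 1)
    (hQ : Q = 1 / (smallBallConst c d r * h ^ d))
    (hΔ : Δ = densityConst 𝒦 Λ B M ρ * (n : ℝ) ^ (-1 / ((k : ℝ) + 2)))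
    (hcc : cc = (c / (r / (2 * R))) ^ d) :
    risk Pr K B h n f P X Y ≤
      (8 * A / (r * h) + 8 * A * LK / (Klow * h) * Q + 2 * A / (R * h)) * Δ +
      Q * (32 * A / (r * h) + 8 * A * LK / (Klow * h) + 8 * A / (R * h * Klow)) * Δ +
      4 * A * √(Q / m) + 4 / Klow * √((2 * A) ^ 2 * cc * Q / m) + L * (2 * R * h) ^ β := by
  have := hs.isProbabilityMeasure
  have := ha.isProbabilityMeasure
  have hr := hK.r_pos
  have hR := hK.R_pos
  have hKl := hK.Klow_pos
  have hm0 : (0 : ℝ) < m := by exact_mod_cast hm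
  have hf := (continuous_of_holder hβ ha.holder).measurable
  have hA0 : 0 < A := by rw [hA]; positivity
  have hc0 := smallBallConst_pos (d := d) hc hr
  have hQ0 : 0 < Q := by rw [hQ]; positivity
  have hcc0 : 0 < cc := by rw [hcc]; positivity
  have hball := ha.doubling.smallBall hc hr hK.r_lt_R hh hh1
  rw [← hQ, ← hcc] at hball
  have hY : ∀ᵐ ω ∂Pr, ∀ i, |Y i ω| ≤ A := by
    refine ae_all_iff.2 fun i => ?_
    filter_upwards [hs.bounded_Y i] with ω hω
    linarith [le_abs_self BY, abs_nonneg fmax]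
  have hfA : ∀ᵐ ω ∂Pr, ∀ i, |f (P i ω)| ≤ A := by
    refine ae_all_iff.2 fun i => ?_
    filter_upwards [hs.ae_law ha.bounded i] with ω hω
    linarith [abs_nonneg BY, le_abs_self fmax]
  have hμA : ∀ i, ∀ᵐ ω ∂Pr, |μ i ω| ≤ 2 * A := fun i => by
    filter_upwards [hY, hfA] with ω h1 h2
    rw [hs.noise_eq i]
    have := _root_.abs_sub (Y i ω) (f (P i ω))
    linarith [h1 i, h2 i]
  obtain ⟨hI1, hW1⟩ := hs.integral_abs_sum_dist_le_sub hf hm (ρ := r * h / 2) hQ0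
    (hball.mono fun s hs => ⟨hs.1, hs.2.1⟩)
  obtain ⟨hI2, hW2⟩ := hs.integral_abs_sum_kernel_mul_noise_le hK hf hm hh (ρ := r * h / 2) hQ0
    (by positivity : 0 < 2 * A) hcc0 hμA hball
  obtain ⟨δ, hδ0, hδI, hδΔ, hδ⟩ := exists_density_error h𝒦 hB hint hn hN ha hs
  rw [← hΔ] at hδΔ
  set W₁ : Ω → ℝ := fun ω =>
    |1 / (m * π.real (Metric.closedBall (P (Fin.last m) ω) (r * h / 2))) *
      ∑ i : Fin m, ((if dist (P i.castSucc ω) (P (Fin.last m) ω) ≤ r * h / 2 then 1 else 0) -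
        π.real (Metric.closedBall (P (Fin.last m) ω) (r * h / 2)))| with hW₁
  set W₂ : Ω → ℝ := fun ω =>
    |1 / (m * π.real (Metric.closedBall (P (Fin.last m) ω) (r * h / 2))) *
      ∑ i : Fin m, K (dist (P i.castSucc ω) (P (Fin.last m) ω) / h) * μ i.castSucc ω| with hW₂
  have hsI : Integrable (fun ω => (∑ i : Fin m, δ i.castSucc ω) / m) Pr :=
    (integrable_finsetSum _ fun i _ => hδI i.castSucc).div_const _
  have hsΔ : ∫ ω, (∑ i : Fin m, δ i.castSucc ω) / m ∂Pr ≤ Δ := by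
    rw [integral_div, integral_finsetSum _ fun i _ => hδI i.castSucc, div_le_iff₀ hm0]
    refine (Finset.sum_le_sum fun i _ => hδΔ i.castSucc).trans_eq ?_
    simp [mul_comm]
  set a₀ := 8 * A / (r * h) + 8 * A * LK / (Klow * h) * Q + 2 * A / (R * h) with ha₀
  set a₁ := Q * (32 * A / (r * h) + 8 * A * LK / (Klow * h) + 8 * A / (R * h * Klow)) with ha₁
  have ha₀0 : 0 ≤ a₀ := by positivity
  have ha₁0 : 0 ≤ a₁ := by positivity
  have hpt : ∀ᵐ ω ∂Pr, absError K B h n f P X Y ω ≤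
      a₀ * δ (Fin.last m) ω + a₁ * ((∑ i : Fin m, δ i.castSucc ω) / m) + 4 * A * W₁ ω +
        4 / Klow * W₂ ω + L * (2 * R * h) ^ β := by
    filter_upwards [hY, hfA, hδ, hs.ae_law hball (Fin.last m)] with ω h1 h2 h3 h4
    obtain ⟨hq0, hqQ, -⟩ := h4
    have h5 := abs_kernel_mean_sub_le hK hm hh hq0 hA0.le hL.le hβ.le
      (D := fun i : Fin m => dist (P i.castSucc ω) (P (Fin.last m) ω))
      (D' := fun i : Fin m =>
        l1Dist (kde B ((n : ℝ) ^ (-1 / ((k : ℝ) + 2))) fun l => X i.castSucc l ω)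
          (kde B ((n : ℝ) ^ (-1 / ((k : ℝ) + 2))) fun l => X (Fin.last m) l ω))
      (δ := fun i => δ i.castSucc ω) (δ₀ := δ (Fin.last m) ω)
      (y := fun i => Y i.castSucc ω) (φ := fun i => f (P i.castSucc ω))
      (ν := fun i => μ i.castSucc ω) (φ₀ := f (P (Fin.last m) ω))
      (fun i => dist_nonneg) (fun i => l1Dist_nonneg _ _) (fun i => hδ0 _ _) (hδ0 _ _)
      (fun i => h3 _ _) (fun i => hs.model _ _) (fun i => h1 _) (fun i => h2 _) (h2 _)
      (fun i => ha.holder _ _)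
    refine (le_of_eq rfl).trans (h5.trans ?_)
    have hs0 : 0 ≤ (∑ i : Fin m, δ i.castSucc ω) / m :=
      div_nonneg (Finset.sum_nonneg fun i _ => hδ0 _ _) hm0.le
    have hd0 := hδ0 (Fin.last m) ω
    rw [hW₁, hW₂]
    dsimp only
    generalize |1 / (m * π.real (Metric.closedBall (P (Fin.last m) ω) (r * h / 2))) *
      ∑ i : Fin m, ((if dist (P i.castSucc ω) (P (Fin.last m) ω) ≤ r * h / 2 then (1 : ℝ) else 0) -
        π.real (Metric.closedBall (P (Fin.last m) ω) (r * h / 2)))| = w₁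
    generalize |1 / (m * π.real (Metric.closedBall (P (Fin.last m) ω) (r * h / 2))) *
      ∑ i : Fin m, K (dist (P i.castSucc ω) (P (Fin.last m) ω) / h) * μ i.castSucc ω| = w₂
    generalize (∑ i : Fin m, δ i.castSucc ω) / m = s at hs0 ⊢
    generalize δ (Fin.last m) ω = t at hd0 ⊢
    generalize π.real (Metric.closedBall (P (Fin.last m) ω) (r * h / 2)) = q at hq0 hqQ ⊢
    calc 2 * A * (4 * t / (r * h) + 16 / (q * r * h) * s + 2 * w₁) + 4 / Klow * w₂ +
          8 * A * LK / (Klow * h * q) * (s + t) + 2 * A / (R * h) * (t + 4 / (Klow * q) * s) +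
          L * (2 * R * h) ^ β
        = (8 * A / (r * h) + 8 * A * LK / (Klow * h) * (1 / q) + 2 * A / (R * h)) * t +
          (1 / q) * (32 * A / (r * h) + 8 * A * LK / (Klow * h) + 8 * A / (R * h * Klow)) * s +
          4 * A * w₁ + 4 / Klow * w₂ + L * (2 * R * h) ^ β := by
          field_simp
          ring
      _ ≤ _ := by
          rw [ha₀, ha₁]
          gcongr
  have hint0 := (hδI (Fin.last m)).const_mul a₀
  have hint1 := hsI.const_mul a₁
  have hint2 := hI1.const_mul (4 * A)
  have hint3 := hI2.const_mul (4 / Klow)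
  refine (integral_mono_ae (integrable_absError hK hB.measurable hβ ha hs hh)
    ((((hint0.add hint1).add hint2).add hint3).add (integrable_const _)) hpt).trans ?_
  have hsum : ∫ ω, (a₀ * δ (Fin.last m) ω + a₁ * ((∑ i : Fin m, δ i.castSucc ω) / m) +
      4 * A * W₁ ω + 4 / Klow * W₂ ω + L * (2 * R * h) ^ β) ∂Pr =
      a₀ * ∫ ω, δ (Fin.last m) ω ∂Pr + a₁ * ∫ ω, (∑ i : Fin m, δ i.castSucc ω) / m ∂Pr +
      4 * A * ∫ ω, W₁ ω ∂Pr + 4 / Klow * ∫ ω, W₂ ω ∂Pr + L * (2 * R * h) ^ β := by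
    have i1 : Integrable (fun ω => a₀ * δ (Fin.last m) ω +
      a₁ * ((∑ i : Fin m, δ i.castSucc ω) / m)) Pr := hint0.add hint1
    have i2 : Integrable (fun ω => a₀ * δ (Fin.last m) ω +
      a₁ * ((∑ i : Fin m, δ i.castSucc ω) / m) + 4 * A * W₁ ω) Pr := i1.add hint2
    have i3 : Integrable (fun ω => a₀ * δ (Fin.last m) ω +
      a₁ * ((∑ i : Fin m, δ i.castSucc ω) / m) + 4 * A * W₁ ω + 4 / Klow * W₂ ω) Pr :=
      i2.add hint3
    rw [integral_add i3 (integrable_const _), integral_add i2 hint3, integral_add i1 hint2,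
      integral_add hint0 hint1]
    simp only [integral_const_mul, integral_const, probReal_univ, one_smul]
  refine hsum.le.trans ?_
  have h0 := hδΔ (Fin.last m)
  gcongr

end Risk

section Constants

variable {k : ℕ} {𝒦 : Set (E k)} {Λ : ℝ≥0} {B : ℝ → ℝ} {LK : ℝ≥0} {Klow r R L β A c d : ℝ}

/-- The constant `C₁` of the risk bound. -/
noncomputable def densityRiskConst (Cδ : ℝ) (LK : ℝ≥0) (Klow r R A c d : ℝ) : ℝ :=
  (8 * A / r + 8 * A * LK / Klow + 2 * A / R +
    (32 * A / r + 8 * A * LK / Klow + 8 * A / (R * Klow))) * Cδ / smallBallConst c d r + 1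

/-- The constant `C₂` of the risk bound. -/
noncomputable def biasRiskConst (R L β A : ℝ) : ℝ := L * (2 * R) ^ β + 2 * A

/-- The constant `C₃` of the risk bound. -/
noncomputable def fluctuationRiskConst (Klow r R A c d : ℝ) : ℝ :=
  4 * A * √(1 / smallBallConst c d r) +
    4 / Klow * √((2 * A) ^ 2 * (c / (r / (2 * R))) ^ d / smallBallConst c d r)

theorem risk_le_riskBound {m : ℕ} {K : ℝ → ℝ} {fmax BY : ℝ} {π : Measure (Distr 𝒦)}
    {f : Distr 𝒦 → ℝ} {n : ℕ} {N : Fin (m + 1) → ℕ} {Ω : Type u} [MeasurableSpace Ω]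
    {Pr : Measure Ω} {P : Fin (m + 1) → Ω → Distr 𝒦}
    {X : ∀ i : Fin (m + 1), Fin (N i) → Ω → E k} {Y μ : Fin (m + 1) → Ω → ℝ} {h : ℝ} {M ρ : ℝ}
    (h𝒦 : IsCompact 𝒦) (hK : IsRegressionKernel K LK Klow r R)
    (hB : HasKernelBound B M ρ) (hint : ∫ x : E k, B ‖x‖ = 1) (hL : 0 < L) (hβ : 0 < β)
    (hc : 0 < c) (hd : 0 ≤ d) (hm : 1 ≤ m) (hn : 1 ≤ n) (hN : ∀ i, n ≤ N i)
    (ha : IsAdmissible Λ L β fmax c d π f) (hs : IsSample Pr π f BY N P X Y μ) (hh : 0 < h)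
    (hA : A = |BY| + |fmax| + 1) :
    risk Pr K B h n f P X Y ≤
      riskBound (densityRiskConst (densityConst 𝒦 Λ B M ρ) LK Klow r R A c d)
        (biasRiskConst R L β A) (fluctuationRiskConst Klow r R A c d) k β d m n h := by
  have hr := hK.r_pos
  have hR := hK.R_pos
  have hKl := hK.Klow_pos
  have hA0 : 0 < A := by rw [hA]; positivity
  have hm0 : (0 : ℝ) < m := by exact_mod_cast hm
  have hn0 : (0 : ℝ) < n := by exact_mod_cast hn
  have hc0 := smallBallConst_pos (d := d) hc hr
  have hc01 := smallBallConst_le_one c d r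
  have hCδ : 0 ≤ densityConst 𝒦 Λ B M ρ := densityConst_nonneg hB
  rw [riskBound]
  set c₀ := smallBallConst c d r with hc₀
  set Cδ := densityConst 𝒦 Λ B M ρ with hCδdef
  set ν := (n : ℝ) ^ (1 / ((k : ℝ) + 2)) with hν
  have hν0 : 0 < ν := by positivity
  have t1 : 0 ≤ densityRiskConst Cδ LK Klow r R A c d / (h ^ (d + 1) * ν) := by
    rw [densityRiskConst, ← hc₀]
    positivity
  have t3 : 0 ≤ fluctuationRiskConst Klow r R A c d * √(1 / (m * h ^ d)) := by
    rw [fluctuationRiskConst, ← hc₀]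
    positivity
  have hLR : 0 < L * (2 * R) ^ β := by positivity
  rcases le_total h 1 with hh1 | hh1
  · have hmain := risk_le_of_le_one h𝒦 hK hB hint hL hβ hc hm hn hN ha hs hh hh1 hA rfl rfl rfl
    rw [bandwidth_eq, ← hν, ← hc₀, ← hCδdef] at hmain
    refine hmain.trans ?_
    have hhd : h ^ d ≤ 1 := Real.rpow_le_one hh.le hh1 hd
    have hhd0 : 0 < h ^ d := by positivity
    have hQ1 : 1 ≤ 1 / (c₀ * h ^ d) := by
      rw [le_div_iff₀ (by positivity), one_mul]
      exact mul_le_one₀ hc01 hhd0.le hhd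
    set Q := 1 / (c₀ * h ^ d) with hQ
    have hsqrt : ∀ V : ℝ, 0 ≤ V → √(V * Q / m) = √(V / c₀) * √(1 / (m * h ^ d)) := fun V hV => by
      rw [← Real.sqrt_mul (by positivity), hQ]
      congr 1
      field_simp
    have hs1 : √(Q / m) = √(1 / c₀) * √(1 / (m * h ^ d)) := by
      rw [← hsqrt 1 zero_le_one, one_mul]
    rw [hs1, hsqrt _ (by positivity)]
    have hb : L * (2 * R * h) ^ β = L * (2 * R) ^ β * h ^ β := by
      rw [Real.mul_rpow (by positivity) hh.le, mul_assoc]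
    have h1 : (8 * A / (r * h) + 8 * A * LK / (Klow * h) * Q + 2 * A / (R * h)) * (Cδ * (1 / ν)) +
        Q * (32 * A / (r * h) + 8 * A * LK / (Klow * h) + 8 * A / (R * h * Klow)) *
          (Cδ * (1 / ν)) ≤ densityRiskConst Cδ LK Klow r R A c d / (h ^ (d + 1) * ν) := by
      have h2 : 8 * A / (r * h) + 8 * A * LK / (Klow * h) * Q + 2 * A / (R * h) ≤
          8 * A / (r * h) * Q + 8 * A * LK / (Klow * h) * Q + 2 * A / (R * h) * Q := by
        gcongr
        · exact le_mul_of_one_le_right (by positivity) hQ1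
        · exact le_mul_of_one_le_right (by positivity) hQ1
      calc _ ≤ (8 * A / (r * h) * Q + 8 * A * LK / (Klow * h) * Q + 2 * A / (R * h) * Q) *
            (Cδ * (1 / ν)) +
            Q * (32 * A / (r * h) + 8 * A * LK / (Klow * h) + 8 * A / (R * h * Klow)) *
            (Cδ * (1 / ν)) := by gcongr
        _ = (8 * A / r + 8 * A * LK / Klow + 2 * A / R +
            (32 * A / r + 8 * A * LK / Klow + 8 * A / (R * Klow))) * Cδ / c₀ /
              (h ^ (d + 1) * ν) := by
            rw [hQ, Real.rpow_add hh, Real.rpow_one]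
            field_simp
        _ ≤ _ := by
            rw [densityRiskConst, ← hc₀]
            gcongr
            exact le_add_of_nonneg_right zero_le_one
    have h3 : 4 * A * (√(1 / c₀) * √(1 / (m * h ^ d))) +
        4 / Klow * (√((2 * A) ^ 2 * (c / (r / (2 * R))) ^ d / c₀) * √(1 / (m * h ^ d))) =
        fluctuationRiskConst Klow r R A c d * √(1 / (m * h ^ d)) := by
      rw [fluctuationRiskConst, ← hc₀]
      ring
    have h4 : L * (2 * R * h) ^ β ≤ biasRiskConst R L β A * h ^ β := by
      rw [hb, biasRiskConst]
      gcongr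
      linarith
    linarith
  · have h1 := risk_le_const (n := n) hK hB.measurable hβ ha hs hh
    rw [← hA] at h1
    have h2 : 1 ≤ h ^ β := Real.one_le_rpow hh1 hβ.le
    have h3 : 2 * A * 1 ≤ biasRiskConst R L β A * h ^ β := by
      rw [biasRiskConst]
      gcongr
      linarith
    linarith

end Constants

end DistReg

open DistReg in
theorem mainTheorem2 {k : ℕ} (hk : 1 ≤ k) {𝒦 : Set (E k)} (h𝒦 : IsCompact 𝒦) (Λ : ℝ≥0)
    {K B : ℝ → ℝ} {LK : ℝ≥0} {Klow r R : ℝ} (hK : IsRegressionKernel K LK Klow r R)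
    (hB : IsDensityKernel k B) {L β : ℝ} (hL : 0 < L) (hβ : 0 < β) (hβ1 : β ≤ 1)
    (fmax BY : ℝ) {c d : ℝ} (hc : 0 < c) (hd : 0 ≤ d) :
    ∃ C₁ C₂ C₃ : ℝ, 0 < C₁ ∧ 0 < C₂ ∧ 0 < C₃ ∧
      -- the risk bound, for every bandwidth
      (∀ (π : Measure (Distr 𝒦)) (f : Distr 𝒦 → ℝ), IsAdmissible Λ L β fmax c d π f →
        ∀ (m n : ℕ), 1 ≤ m → 1 ≤ n → ∀ N : Fin (m + 1) → ℕ, (∀ i, n ≤ N i) →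
        ∀ (Ω : Type u) [MeasurableSpace Ω] (Pr : Measure Ω) (P : Fin (m + 1) → Ω → Distr 𝒦)
          (X : ∀ i : Fin (m + 1), Fin (N i) → Ω → E k) (Y μ : Fin (m + 1) → Ω → ℝ),
        IsSample Pr π f BY N P X Y μ → ∀ h : ℝ, 0 < h →
          Integrable (absError K B h n f P X Y) Pr ∧
          risk Pr K B h n f P X Y ≤ riskBound C₁ C₂ C₃ k β d m n h) ∧
      -- no bandwidth makes the bound smaller than either rate, up to a constant
      (∃ c₀ : ℝ, 0 < c₀ ∧ ∀ (m n : ℕ), 1 ≤ m → 1 ≤ n → ∀ h : ℝ, 0 < h →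
        c₀ * rateM β d m ≤ riskBound C₁ C₂ C₃ k β d m n h ∧
        c₀ * rateN k β d n ≤ riskBound C₁ C₂ C₃ k β d m n h) ∧
      -- the rates, for bandwidths of the optimal order
      (∀ a lo hi : ℝ, 0 < a → 0 < lo → lo ≤ hi → ∃ C : ℝ, 0 < C ∧
        ∀ (π : Measure (Distr 𝒦)) (f : Distr 𝒦 → ℝ), IsAdmissible Λ L β fmax c d π f →
        ∀ (m n : ℕ), 1 ≤ m → 1 ≤ n → ∀ N : Fin (m + 1) → ℕ, (∀ i, n ≤ N i) →
        ∀ (Ω : Type u) [MeasurableSpace Ω] (Pr : Measure Ω) (P : Fin (m + 1) → Ω → Distr 𝒦)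
          (X : ∀ i : Fin (m + 1), Fin (N i) → Ω → E k) (Y μ : Fin (m + 1) → Ω → ℝ),
        IsSample Pr π f BY N P X Y μ → ∀ h : ℝ,
          (a * threshold k β d m ≤ n → lo * bandM β d m ≤ h → h ≤ hi * bandM β d m →
            risk Pr K B h n f P X Y ≤ C * rateM β d m) ∧
          (n ≤ a * threshold k β d m → lo * bandN k β d n ≤ h → h ≤ hi * bandN k β d n →
            risk Pr K B h n f P X Y ≤ C * rateN k β d n)) := by
  obtain ⟨M, ρ, hBb⟩ := hB.exists_hasKernelBound
  have hr := hK.r_pos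
  have hR := hK.R_pos
  have hKl := hK.Klow_pos
  set A := |BY| + |fmax| + 1 with hA
  have hA0 : 0 < A := by positivity
  have hc0 := smallBallConst_pos (d := d) hc hr
  have hCδ : 0 ≤ densityConst 𝒦 Λ B M ρ := densityConst_nonneg hBb
  have h₁ : 0 < densityRiskConst (densityConst 𝒦 Λ B M ρ) LK Klow r R A c d := by
    rw [densityRiskConst]
    positivity
  have h₂ : 0 < biasRiskConst R L β A := by
    rw [biasRiskConst]
    positivity
  have h₃ : 0 < fluctuationRiskConst Klow r R A c d := by
    rw [fluctuationRiskConst]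
    positivity
  refine ⟨_, _, _, h₁, h₂, h₃, ?_, ?_, ?_⟩
  · intro π f ha m n hm hn N hN Ω _ Pr P X Y μ hs h hh
    exact ⟨integrable_absError hK hB.measurable hβ ha hs hh,
      risk_le_riskBound h𝒦 hK hBb hB.integral_eq_one hL hβ hc hd hm hn hN ha hs hh hA⟩
  · exact ⟨_, lt_min h₁ (lt_min h₂ h₃), fun m n hm hn h hh =>
      ⟨le_riskBound_rateM h₁ h₂ h₃ k hβ hd hm hh, le_riskBound_rateN h₁ h₂ h₃ k hβ hd hn hh⟩⟩
  · intro a lo hi h_a hlo hlh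
    have hhi : 0 < hi := hlo.trans_le hlh
    refine ⟨max
      (densityRiskConst (densityConst 𝒦 Λ B M ρ) LK Klow r R A c d /
          (lo ^ (d + 1) * a ^ (1 / ((k : ℝ) + 2))) + biasRiskConst R L β A * hi ^ β +
        fluctuationRiskConst Klow r R A c d * √(1 / lo ^ d))
      (densityRiskConst (densityConst 𝒦 Λ B M ρ) LK Klow r R A c d / lo ^ (d + 1) +
        biasRiskConst R L β A * hi ^ β + fluctuationRiskConst Klow r R A c d *
          √(a ^ ((2 * β + d) / ((β + d + 1) * ((k : ℝ) + 2))) / lo ^ d)),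
      lt_max_of_lt_left (by positivity), ?_⟩
    intro π f ha m n hm hn N hN Ω _ Pr P X Y μ hs h
    have hrisk : 0 < h → _ := fun hh =>
      risk_le_riskBound h𝒦 hK hBb hB.integral_eq_one hL hβ hc hd hm hn hN ha hs hh hA
    refine ⟨fun hn' h1 h2 => ?_, fun hn' h1 h2 => ?_⟩
    · refine ((hrisk ((mul_pos hlo (bandM_pos hm)).trans_le h1)).trans
        (riskBound_le_rateM h₁ h₂ h₃ k hβ hd h_a hlo hm hn' h1 h2 hlh)).trans ?_
      exact mul_le_mul_of_nonneg_right (le_max_left _ _) (rateM_pos hm).le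
    · refine ((hrisk ((mul_pos hlo (bandN_pos hn)).trans_le h1)).trans
        (riskBound_le_rateN h₁ h₂ h₃ k hβ hd h_a hlo hm hn hn' h1 h2 hlh)).trans ?_
      exact mul_le_mul_of_nonneg_right (le_max_right _ _) (rateN_pos hn).le
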